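/- Let $\mathbb{T}^n=(\mathbb{R}/\mathbb{Z})^n$ act smoothly on a smooth manifold $X$ (Hausdorff, second countable, finite-dimensional, without boundary), for instance on the total space of a principal $\mathbb{T}^n$-bundle. Let $\tfrac{\partial}{\partial\theta_I}$, $I=1,\dots,n$, be the fundamental vector fields and $\mathcal{L}(\tfrac{\partial}{\partial\theta_I})$ the Lie derivatives along them. Let $\{\mathcal{U}_\alpha\}$ be a contractible (good) open covering of $X$: every nonempty overlap $\mathcal{U}_\alpha$, $\mathcal{U}_{\alpha\beta}=\mathcal{U}_\alpha\cap\mathcal{U}_\beta$, $\mathcal{U}_{\alpha\beta\gamma}=\mathcal{U}_\alpha\cap\mathcal{U}_\beta\cap\mathcal{U}_\gamma$ is contractible. A gerbe with connection with respect to this covering consists of smooth $2$-forms $B_\alpha$ on $\mathcal{U}_\alpha$, smooth $1$-forms $A_{\alpha\beta}=-A_{\beta\alpha}$ on $\mathcal{U}_{\alpha\beta}$ and smooth functions $f_{\alpha\beta\gamma}:\mathcal{U}_{\alpha\beta\gamma}\to U(1)$, with $f_{\beta\alpha\gamma}=f_{\alpha\gamma\beta}=f_{\alpha\beta\gamma}^{-1}$,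 such that $$B_\alpha-B_\beta=dA_{\alpha\beta},\qquad A_{\alpha\beta}+A_{\beta\gamma}+A_{\gamma\alpha}=\frac{1}{2\pi i}f_{\alpha\beta\gamma}^{-1}\,df_{\alpha\beta\gamma},\qquad f_{\alpha\beta\gamma}f_{\beta\gamma\delta}^{-1}f_{\gamma\delta\alpha}f_{\delta\alpha\beta}^{-1}=1$$ on twofold, threefold and fourfold overlaps respectively. Its curvature is the global $3$-form $H$ with $H|_{\mathcal{U}_\alpha}=dB_\alpha$. Assume that $H$ is $\mathbb{T}^n$-invariant. Then the torus action on the gerbe connection is specified by smooth $1$-forms $w^I_\alpha$ on $\mathcal{U}_\alpha$, smooth functions $u^I_{\alpha\beta}=-u^I_{\beta\alpha}$ on $\mathcal{U}_{\alpha\beta}$ and real constants $c^I_{\alpha\beta\gamma}$, for $I=1,\dots,n$, satisfying \begin{align} \mathcal{L}(\tfrac{\partial}{\partial\theta_I})B_\alpha&=dw^I_\alpha &&\text{on }\mathcal{U}_\alpha,\tag{a}\\ w^I_\alpha-w^I_\beta&=\mathcal{L}(\tfrac{\partial}{\partial\theta_I})A_{\alpha\beta}+du^I_{\alpha\beta}&&\text{on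 }\mathcal{U}_{\alpha\beta},\tag{b}\\ u^I_{\alpha\beta}+u^I_{\beta\gamma}+u^I_{\gamma\alpha}&=c^I_{\alpha\beta\gamma}-\frac{1}{2\pi i}\mathcal{L}(\tfrac{\partial}{\partial\theta_I})\log f_{\alpha\beta\gamma}&&\text{on }\mathcal{U}_{\alpha\beta\gamma},\tag{c}\\ c^I_{\alpha\beta\gamma}-c^I_{\beta\gamma\delta}+c^I_{\gamma\delta\alpha}-c^I_{\delta\alpha\beta}&\in\mathbb{Z}&&\text{if }\mathcal{U}_{\alpha\beta\gamma\delta}=\mathcal{U}_\alpha\cap\mathcal{U}_\beta\cap\mathcal{U}_\gamma\cap\mathcal{U}_\delta\neq\emptyset,\tag{d} \end{align} in the following sense: forms $w$ satisfying (a) exist; for every choice of $w$ satisfying (a) there are skew-symmetric $u$ satisfying (b); for every such choice of $w$ and $u$ there are constants $c$ satisfying (c); and all constants $c$ obtained in this way satisfy (d). Here $\mathcal{L}(\tfrac{\partial}{\partial\theta_I})\log f$ denotes $f^{-1}\mathcal{L}(\tfrac{\partial}{\partial\theta_I})f$. -/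

import Mathlib

open scoped Manifold ContDiff

noncomputable section

namespace GerbeTorus

/-- The torus `𝕋ⁿ = (ℝ/ℤ)ⁿ`. -/
abbrev Torus (n : ℕ) : Type := Fin n → UnitAddCircle

/-- The class in `𝕋ⁿ` of a vector of `ℝⁿ`. -/
def torusMk (n : ℕ) (s : Fin n → ℝ) : Torus n := fun i => (s i : UnitAddCircle)

section Forms

variable {d : ℕ} {X : Type*} [TopologicalSpace X] [ChartedSpace (EuclideanSpace ℝ (Fin d)) X]

variable (d X) in
/-- A field of alternating `k`-linear forms on the tangent spaces of the `d`-manifold `X`.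
A differential form on an open set `U` is such a field that is smooth on `U`
(see `Form.SmoothOn`); its values outside `U` are irrelevant. -/
abbrev Form (k : ℕ) : Type _ := (x : X) → TangentSpace (𝓡 d) x [⋀^Fin k]→L[ℝ] ℝ

/-- The pullback `g^* η` of a form under a self-map of `X`. -/
def Form.pullback {k : ℕ} (g : X → X) (η : Form d X k) : Form d X k := fun x =>
  (η (g x)).compContinuousLinearMap (mfderiv (𝓡 d) (𝓡 d) g x)

/-- The expression of a form in the preferred chart at `x₀`, that is, its pullback under the
inverse of this chart. -/
def Form.inChart {k : ℕ} (η : Form d X k) (x₀ : X) :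
    EuclideanSpace ℝ (Fin d) → EuclideanSpace ℝ (Fin d) [⋀^Fin k]→L[ℝ] ℝ := fun y =>
  (η ((extChartAt (𝓡 d) x₀).symm y)).compContinuousLinearMap
    (mfderiv 𝓘(ℝ, EuclideanSpace ℝ (Fin d)) (𝓡 d) (extChartAt (𝓡 d) x₀).symm y)

/-- `η` is a smooth differential form on the open set `U`: its expression in every chart is
smooth on the part of the chart domain that lies in `U`. -/
def Form.SmoothOn {k : ℕ} (η : Form d X k) (U : Set X) : Prop :=
  ∀ x₀ : X, ContDiffOn ℝ ∞ (η.inChart x₀)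
    ((extChartAt (𝓡 d) x₀).target ∩ (extChartAt (𝓡 d) x₀).symm ⁻¹' U)

/-- The exterior derivative, computed at each point in the preferred chart at this point. -/
def Form.extd {k : ℕ} (η : Form d X k) : Form d X (k + 1) := fun x =>
  (extDeriv (η.inChart x) (extChartAt (𝓡 d) x x)).compContinuousLinearMap
    (mfderiv (𝓡 d) 𝓘(ℝ, EuclideanSpace ℝ (Fin d)) (extChartAt (𝓡 d) x) x)

variable (d) in
/-- A real function, as a `0`-form. -/
def Form.ofFun (u : X → ℝ) : Form d X 0 := fun x =>
  ContinuousAlternatingMap.constOfIsEmpty ℝ (TangentSpace (𝓡 d) x) (Fin 0) (u x)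

end Forms

section Action

variable {n d : ℕ} {X : Type*} [TopologicalSpace X] [ChartedSpace (EuclideanSpace ℝ (Fin d)) X]
  [AddAction (Torus n) X]

variable (n d X) in
/-- The action of `𝕋ⁿ` on `X` is smooth. Since `𝕋ⁿ` carries the quotient smooth structure of
`ℝⁿ`, this is smoothness of the induced action map `ℝⁿ × X → X`. -/
def SmoothTorusAction : Prop :=
  ContMDiff (𝓘(ℝ, Fin n → ℝ).prod (𝓡 d)) (𝓡 d) ∞
    (fun p : (Fin n → ℝ) × X => torusMk n p.1 +ᵥ p.2)

/-- The flow `ℝ × X → X` of the fundamental vector field `∂/∂θ_i`: at time `t`, translation by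
`t e_i`. -/
def flow (i : Fin n) (t : ℝ) (x : X) : X := torusMk n (Pi.single i t) +ᵥ x

variable (n) in
/-- `η` is invariant under the action of `𝕋ⁿ`. -/
def Form.Invariant {k : ℕ} (η : Form d X k) : Prop :=
  ∀ t : Torus n, η.pullback (fun x => t +ᵥ x) = η

/-- The Lie derivative `ℒ(∂/∂θ_i) η`: the derivative at time `0` of the pullback of `η` under the
flow of `∂/∂θ_i`. For fixed `x` and varying `t` these are elements of one vector space, that of
alternating forms on the tangent space at `x`, which is a copy of the model space. -/
def Form.lie {k : ℕ} (i : Fin n) (η : Form d X k) : Form d X k := fun x =>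
  deriv (F := EuclideanSpace ℝ (Fin d) [⋀^Fin k]→L[ℝ] ℝ) (fun t : ℝ => η.pullback (flow i t) x) 0

/-- `ℒ(∂/∂θ_i) log f` for a `U(1)`-valued function `f`. The logarithm is defined locally up to a
constant, so its derivative is `f⁻¹ ℒ(∂/∂θ_i) f`, which takes values in `iℝ ⊆ ℂ`. -/
def lieLog (i : Fin n) (f : X → Circle) (x : X) : ℂ :=
  (f x : ℂ)⁻¹ * deriv (fun t : ℝ => (f (flow i t x) : ℂ)) 0

end Action

section Gerbe

variable {d : ℕ} {X ι : Type*} [TopologicalSpace X] [ChartedSpace (EuclideanSpace ℝ (Fin d)) X]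

/-- A contractible (good) open covering: all nonempty overlaps of at most three members (allow
coinciding indices) are contractible. Nothing is required of higher overlaps. -/
structure IsContractibleCover (U : ι → Set X) : Prop where
  isOpen : ∀ α, IsOpen (U α)
  cover : ⋃ α, U α = Set.univ
  contractible : ∀ α β γ, (U α ∩ U β ∩ U γ).Nonempty →
    ContractibleSpace (U α ∩ U β ∩ U γ : Set X)

variable (d) in
/-- A gerbe with connection on `X`, in terms of local data with respect to a covering `U`:
`U(1)`-valued functions `f α β γ` on threefold overlaps, `1`-forms `A α β` on twofold overlaps and
`2`-forms `B α` on the members of the covering. -/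
structure GerbeConnection (U : ι → Set X) where
  B : ι → Form d X 2
  A : ι → ι → Form d X 1
  f : ι → ι → ι → X → Circle
  smooth_B : ∀ α, (B α).SmoothOn (U α)
  smooth_A : ∀ α β, (A α β).SmoothOn (U α ∩ U β)
  smooth_f : ∀ α β γ,
    ContMDiffOn (𝓡 d) 𝓘(ℝ, ℂ) ∞ (fun x => (f α β γ x : ℂ)) (U α ∩ U β ∩ U γ)
  skew_A : ∀ α β, ∀ x ∈ U α ∩ U β, A β α x = -A α β x
  skew_f₁₂ : ∀ α β γ, ∀ x ∈ U α ∩ U β ∩ U γ, f β α γ x = (f α β γ x)⁻¹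
  skew_f₂₃ : ∀ α β γ, ∀ x ∈ U α ∩ U β ∩ U γ, f α γ β x = (f α β γ x)⁻¹
  /-- The cocycle condition on fourfold overlaps. -/
  cocycle : ∀ α β γ δ, ∀ x ∈ U α ∩ U β ∩ U γ ∩ U δ,
    f α β γ x * (f β γ δ x)⁻¹ * f γ δ α x * (f δ α β x)⁻¹ = 1
  /-- `A α β + A β γ + A γ α = (2πi)⁻¹ f⁻¹ df` on threefold overlaps. -/
  glue_A : ∀ α β γ, ∀ x ∈ U α ∩ U β ∩ U γ, ∀ v : TangentSpace (𝓡 d) x,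
    (((A α β x + A β γ x + A γ α x) (fun _ => v) : ℝ) : ℂ) =
      1 / (2 * Real.pi * Complex.I) * ((f α β γ x : ℂ)⁻¹ *
        (show ℂ from mfderiv (𝓡 d) 𝓘(ℝ, ℂ) (fun y => (f α β γ y : ℂ)) x v))
  /-- `B α - B β = d (A α β)` on twofold overlaps. -/
  glue_B : ∀ α β, ∀ x ∈ U α ∩ U β, B α x - B β x = (A α β).extd x

namespace GerbeConnection

variable {U : ι → Set X} (G : GerbeConnection d U)

/-- The `3`-form `H` is the curvature: `H = d (B α)` on every `U α`. -/
def IsCurvature (H : Form d X 3) : Prop :=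
  ∀ α, ∀ x ∈ U α, H x = (G.B α).extd x

variable {n : ℕ} [AddAction (Torus n) X]

/-- `w α i` are `1`-forms on `U α` with `ℒ(∂/∂θ_i) (B α) = d (w α i)`. -/
def PatchCondition (w : ι → Fin n → Form d X 1) : Prop :=
  (∀ α i, (w α i).SmoothOn (U α)) ∧
  ∀ α i, ∀ x ∈ U α, (G.B α).lie i x = (w α i).extd x

/-- `u α β i` are functions on `U α ∩ U β`, skew-symmetric in `α, β`, such that
`w α i - w β i = ℒ(∂/∂θ_i) (A α β) + d (u α β i)` on twofold overlaps. -/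
def TwofoldCondition (w : ι → Fin n → Form d X 1) (u : ι → ι → Fin n → X → ℝ) : Prop :=
  (∀ α β i, ContMDiffOn (𝓡 d) 𝓘(ℝ, ℝ) ∞ (u α β i) (U α ∩ U β)) ∧
  (∀ α β i, ∀ x ∈ U α ∩ U β, u β α i x = -u α β i x) ∧
  ∀ α β i, ∀ x ∈ U α ∩ U β,
    w α i x - w β i x = (G.A α β).lie i x + (Form.ofFun d (u α β i)).extd x

/-- `c α β γ i` are constants such that
`u α β i + u β γ i + u γ α i = c α β γ i - (2πi)⁻¹ ℒ(∂/∂θ_i) log (f α β γ)` on threefold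
overlaps. -/
def ThreefoldCondition (u : ι → ι → Fin n → X → ℝ) (c : ι → ι → ι → Fin n → ℝ) : Prop :=
  ∀ α β γ i, ∀ x ∈ U α ∩ U β ∩ U γ,
    ((u α β i x + u β γ i x + u γ α i x : ℝ) : ℂ) =
      (c α β γ i : ℂ) - 1 / (2 * Real.pi * Complex.I) * lieLog i (G.f α β γ) x

end GerbeConnection

/-- `c α β γ i - c β γ δ i + c γ δ α i - c δ α β i` is an integer for every nonempty fourfold
overlap. -/
def FourfoldCondition {n : ℕ} (U : ι → Set X) (c : ι → ι → ι → Fin n → ℝ) : Prop :=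
  ∀ α β γ δ, (U α ∩ U β ∩ U γ ∩ U δ).Nonempty → ∀ i, ∃ m : ℤ,
    c α β γ i - c β γ δ i + c γ δ α i - c δ α β i = m

end Gerbe

end GerbeTorus

end

/-! The torus need not preserve the patches, but a Lie derivative at a point depends only on the
germ there, so `ℒ` acts on the local data of the gerbe and commutes with `d`. The equations then
follow by descent. Invariance gives `d ℒB_α = ℒH = 0`, so `ℒB_α` is closed and hence exact on the
contractible patch: (a). Applying `ℒ` to `B_α - B_β = dA_αβ` shows that `w_α - w_β - ℒA_αβ` is
closed, hence exact on the contractible double overlap; averaging over the two orders of the indices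
makes the primitive skew: (b). Writing `f_αβγ = const · exp(2πiθ)` locally and applying `ℒ` to the
sum of the `A`'s, which is `dθ`, shows that the sum of the `u`'s plus `ℒθ` has zero differential, so
it is constant on the connected triple overlap: (c). In the alternating sum of the `c`'s, the `u`'s
cancel by skewness and the terms `ℒ log f` by the cocycle condition, so the integer in (d) is in
fact `0`.

The analytic weight lies in the exactness of closed `1`- and `2`-forms on a contractible open set
(`Form.exists_primitive_of_contractible`, `Form.exists_one_form_primitive_of_contractible`). The
contraction is only continuous, so forms cannot be pulled back along it. Forms are therefore traded
for Alexander–Spanier cochains, that is, arbitrary functions of nearby points: a `1`-form gives the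
function of pairs that integrates it along chart segments. For such cochains homotopy invariance
needs only continuity: the tracks of the homotopy are cut into short dyadic pieces and the usual
prism sums are formed (`exists_eq_sub_of_contractible`, `exists_eq_coboundary_of_contractible`). The
Poincaré lemma on balls links the two sides. In degree one the resulting function differs from each
local primitive by a constant, so it is itself a smooth primitive. In degree two the cochain
supplies functions, possibly not smooth, whose differences are smooth potentials for the differences
of the local primitives; a partition of unity makes the correction smooth and glues. -/

noncomputable section
namespace GerbeTorus

/-! ### Alexander–Spanier cochains on a contractible space -/

section AlexanderSpanier

open Filter Topology

/-- Sums over dyadic subdivisions become stationary from a level that depends on the neighbourhood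
considered. Taking the limit yields one value per index, chosen before any neighbourhood or level is
known; where the sequence does not stabilize the value is irrelevant. -/
theorem exists_eventual_value {κ : Type*} (A : κ → ℕ → ℝ) :
    ∃ a : κ → ℝ, ∀ i n₀, (∀ n ≥ n₀, A i (n + 1) = A i n) → ∀ n ≥ n₀, a i = A i n := by
  refine ⟨fun i => limUnder atTop (A i), fun i n₀ h n hn => ?_⟩
  have hconst : ∀ m ≥ n, A i m = A i n := fun m hm =>
    Nat.le_induction rfl (fun k hk ih => (h k (hn.trans hk)).trans ih) m hm
  exact (tendsto_const_nhds.congr' ((eventually_ge_atTop n).mono fun m hm =>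
    (hconst m hm).symm)).limUnder_eq

theorem sum_range_two_pow_succ (g : ℕ → ℝ) (n : ℕ) :
    ∑ k ∈ Finset.range (2 ^ (n + 1)), g k =
      ∑ k ∈ Finset.range (2 ^ n), (g (2 * k) + g (2 * k + 1)) := by
  have : ∀ m : ℕ, ∑ k ∈ Finset.range (2 * m), g k =
      ∑ k ∈ Finset.range m, (g (2 * k) + g (2 * k + 1)) := by
    intro m
    induction m with
    | zero => simp
    | succ m ih => rw [Finset.sum_range_succ, ← ih, mul_add, mul_one, Finset.sum_range_succ,
        Finset.sum_range_succ, add_assoc]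
  rw [pow_succ', this]

variable {Y : Type*} [TopologicalSpace Y]

/-- A contraction, extended to all real times. -/
theorem exists_contraction (Y : Type*) [TopologicalSpace Y] [ContractibleSpace Y] :
    ∃ (H : ℝ → Y → Y) (b : Y), Continuous (fun p : ℝ × Y => H p.1 p.2) ∧ (∀ y, H 0 y = y) ∧
      ∀ y, H 1 y = b := by
  obtain ⟨b, ⟨F⟩⟩ := (contractible_iff_id_nullhomotopic Y).1 ‹_›
  refine ⟨fun t y => F (Set.projIcc 0 1 zero_le_one t, y), b, ?_, fun y => ?_, fun y => ?_⟩
  · exact F.continuous.comp ((continuous_projIcc.comp continuous_fst).prodMk continuous_snd)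
  · simp
  · simp

/-- The tracks of points close to `p` under a homotopy are, in sufficiently small dyadic time
intervals, simultaneously small. -/
theorem exists_dyadic_small {H : ℝ → Y → Y} (hH : Continuous fun p : ℝ × Y => H p.1 p.2)
    {P : Set Y → Prop} (hP : ∀ p, ∃ N ∈ 𝓝 p, P N) (p : Y) :
    ∃ W ∈ 𝓝 p, ∃ n₀ : ℕ, ∀ n ≥ n₀, ∀ k : ℕ, k < 2 ^ n → ∃ N, P N ∧ ∀ x ∈ W,
      ∀ t ∈ Set.Icc ((k : ℝ) / 2 ^ n) ((k + 1 : ℝ) / 2 ^ n), H t x ∈ N := by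
  choose N hN hPN using hP
  have hloc : ∀ t : ℝ, ∃ u, IsOpen u ∧ t ∈ u ∧ ∃ v ∈ 𝓝 p, ∀ s ∈ u, ∀ x ∈ v, H s x ∈ N (H t p) := by
    intro t
    have h1 : (fun q : ℝ × Y => H q.1 q.2) ⁻¹' N (H t p) ∈ 𝓝 (t, p) :=
      hH.continuousAt.preimage_mem_nhds (hN (H t p))
    obtain ⟨u, hu, v, hv, huv⟩ := mem_nhds_prod_iff.1 h1
    obtain ⟨u', hu', hu'o, htu'⟩ := mem_nhds_iff.1 hu
    exact ⟨u', hu'o, htu', v, hv, fun s hs x hx => huv (Set.mk_mem_prod (hu' hs) hx)⟩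
  choose u huo htu v hv huv using hloc
  -- Tube argument: finitely many boxes cover `[0,1] × {p}`. Dyadic intervals shorter than a
  -- Lebesgue number of their time sides lie in a single box.
  obtain ⟨T, -, hT⟩ := (isCompact_Icc (a := (0 : ℝ)) (b := 1)).elim_nhds_subcover u
    fun t _ => (huo t).mem_nhds (htu t)
  obtain ⟨δ, hδ, hball⟩ := lebesgue_number_lemma_of_metric (isCompact_Icc (a := (0 : ℝ)) (b := 1))
    (c := fun t : T => u t) (fun t => huo t) (by simpa [Set.iUnion_subtype] using hT)
  refine ⟨⋂ t ∈ T, v t, (biInter_finset_mem T).2 fun t _ => hv t, ?_⟩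
  obtain ⟨n₀, hn₀⟩ := exists_pow_lt_of_lt_one hδ (by norm_num : (1 / 2 : ℝ) < 1)
  refine ⟨n₀, fun n hn k hk => ?_⟩
  have hpos : (0 : ℝ) < 2 ^ n := by positivity
  have hkn : (k : ℝ) / 2 ^ n ∈ Set.Icc (0 : ℝ) 1 := by
    refine ⟨by positivity, (div_le_one hpos).2 ?_⟩
    exact_mod_cast hk.le
  obtain ⟨t, ht⟩ := hball _ hkn
  refine ⟨N (H t p), hPN _, fun x hx s hs => huv t s (ht ?_) x (Set.mem_iInter₂.1 hx t t.2)⟩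
  have h2 : (1 / 2 : ℝ) ^ n ≤ (1 / 2) ^ n₀ := pow_le_pow_of_le_one (by norm_num) (by norm_num) hn
  rw [Metric.mem_ball, Real.dist_eq, abs_of_nonneg (by linarith [hs.1])]
  have h3 : ((k : ℝ) + 1) / 2 ^ n = k / 2 ^ n + (1 / 2) ^ n := by
    rw [one_div_pow]; ring
  linarith [hs.2]

/-- A function of pairs that is locally a difference is a difference near the diagonal, on a
contractible space. -/
theorem exists_eq_sub_of_contractible [ContractibleSpace Y] (c : Y → Y → ℝ)
    (hc : ∀ p, ∃ N ∈ 𝓝 p, ∃ g : Y → ℝ, ∀ x ∈ N, ∀ y ∈ N, c x y = g y - g x) :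
    ∃ f : Y → ℝ, ∀ p, ∃ N ∈ 𝓝 p, ∀ x ∈ N, ∀ y ∈ N, c x y = f y - f x := by
  obtain ⟨H, b, hH, H0, H1⟩ := exists_contraction Y
  -- Minus the sum of `c` along the track from `x` to `b`, the discrete analogue of a line integral
  -- normalized to vanish at the end point.
  obtain ⟨f, hf⟩ := exists_eventual_value fun (x : Y) (n : ℕ) =>
    -∑ k ∈ Finset.range (2 ^ n), c (H ((k : ℕ) / 2 ^ n) x) (H ((k + 1 : ℕ) / 2 ^ n) x)
  refine ⟨f, fun p => ?_⟩
  obtain ⟨W, hW, n₀, hn₀⟩ := exists_dyadic_small hH hc p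
  refine ⟨W, hW, ?_⟩
  have hval : ∀ x ∈ W, ∀ n ≥ n₀, f x =
      -∑ k ∈ Finset.range (2 ^ n), c (H ((k : ℕ) / 2 ^ n) x) (H ((k + 1 : ℕ) / 2 ^ n) x) := by
    intro x hx
    refine hf x n₀ fun n hn => ?_
    rw [sum_range_two_pow_succ, neg_inj]
    refine Finset.sum_congr rfl fun k hk => ?_
    obtain ⟨N, ⟨g, hg⟩, hN⟩ := hn₀ n hn k (Finset.mem_range.1 hk)
    have hpos : (0 : ℝ) < 2 ^ n := by positivity
    have e0 : ((2 * k : ℕ) : ℝ) / 2 ^ (n + 1) = k / 2 ^ n := by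
      rw [pow_succ]; push_cast; field_simp
    have e2 : ((2 * k + 1 + 1 : ℕ) : ℝ) / 2 ^ (n + 1) = (k + 1 : ℕ) / 2 ^ n := by
      rw [pow_succ]; push_cast; field_simp; ring
    have m0 := hN x hx (k / 2 ^ n) ⟨le_rfl, by gcongr; linarith⟩
    have m1 := hN x hx ((2 * k + 1 : ℕ) / 2 ^ (n + 1)) (by
      rw [pow_succ]; push_cast
      constructor
      · rw [div_le_div_iff₀ hpos (by positivity)]; nlinarith
      · rw [div_le_div_iff₀ (by positivity) hpos]; nlinarith)
    have m2 := hN x hx ((k + 1 : ℕ) / 2 ^ n) ⟨by push_cast; gcongr; linarith, by push_cast; rfl⟩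
    rw [e0, e2, hg _ m0 _ m1, hg _ m1 _ m2, hg _ m0 _ m2]
    ring
  intro x hx y hy
  rw [hval x hx n₀ le_rfl, hval y hy n₀ le_rfl]
  -- The four corners of the square between the tracks of `x` and `y` lie in one set on which `c` is
  -- a difference, so `c` sums to zero around it. Summing over `k` leaves only the edges at times
  -- `0` and `1`.
  have key : ∀ k ∈ Finset.range (2 ^ n₀),
      c (H ((k : ℕ) / 2 ^ n₀) x) (H ((k + 1 : ℕ) / 2 ^ n₀) x) -
        c (H ((k : ℕ) / 2 ^ n₀) y) (H ((k + 1 : ℕ) / 2 ^ n₀) y) =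
      c (H ((k : ℕ) / 2 ^ n₀) x) (H ((k : ℕ) / 2 ^ n₀) y) -
        c (H ((k + 1 : ℕ) / 2 ^ n₀) x) (H ((k + 1 : ℕ) / 2 ^ n₀) y) := by
    intro k hk
    obtain ⟨N, ⟨g, hg⟩, hN⟩ := hn₀ n₀ le_rfl k (Finset.mem_range.1 hk)
    have t0 : (k : ℝ) / 2 ^ n₀ ∈ Set.Icc ((k : ℝ) / 2 ^ n₀) ((k + 1 : ℝ) / 2 ^ n₀) :=
      ⟨le_rfl, by gcongr; linarith⟩
    have t1 : ((k + 1 : ℕ) : ℝ) / 2 ^ n₀ ∈ Set.Icc ((k : ℝ) / 2 ^ n₀) ((k + 1 : ℝ) / 2 ^ n₀) :=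
      ⟨by push_cast; gcongr; linarith, by push_cast; rfl⟩
    rw [hg _ (hN x hx _ t0) _ (hN x hx _ t1), hg _ (hN y hy _ t0) _ (hN y hy _ t1),
      hg _ (hN x hx _ t0) _ (hN y hy _ t0), hg _ (hN x hx _ t1) _ (hN y hy _ t1)]
    ring
  have htel := (Finset.sum_congr rfl key).trans (Finset.sum_range_sub' (fun k : ℕ =>
    c (H ((k : ℕ) / 2 ^ n₀) x) (H ((k : ℕ) / 2 ^ n₀) y)) (2 ^ n₀))
  have hb : c b b = 0 := by
    obtain ⟨N, hN, g, hg⟩ := hc b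
    rw [hg b (mem_of_mem_nhds hN) b (mem_of_mem_nhds hN), sub_self]
  have e1 : ((2 ^ n₀ : ℕ) : ℝ) / 2 ^ n₀ = 1 := by push_cast; exact div_self (by positivity)
  rw [Finset.sum_sub_distrib, e1, H1, H1, hb, Nat.cast_zero, zero_div, H0, H0] at htel
  linarith

/-- A function of triples that is locally a coboundary is a coboundary near the diagonal, on a
contractible space. -/
theorem exists_eq_coboundary_of_contractible [ContractibleSpace Y] (c : Y → Y → Y → ℝ)
    (hc : ∀ p, ∃ N ∈ 𝓝 p, ∃ l : Y → Y → ℝ, ∀ x ∈ N, ∀ y ∈ N, ∀ z ∈ N,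
      c x y z = l x y + l y z - l x z) :
    ∃ a : Y → Y → ℝ, ∀ p, ∃ N ∈ 𝓝 p, ∀ x ∈ N, ∀ y ∈ N, ∀ z ∈ N,
      c x y z = a x y + a y z - a x z := by
  obtain ⟨H, b, hH, H0, H1⟩ := exists_contraction Y
  set pt : ℕ → ℕ → Y → Y := fun n k x => H ((k : ℕ) / 2 ^ n) x with hpt
  set Q : ℕ → ℕ → Y → Y → ℝ := fun n k x y =>
    -- The prism operator: the square between two tracks is cut into two triangles.
    c (pt n k x) (pt n k y) (pt n (k + 1) y) - c (pt n k x) (pt n (k + 1) x) (pt n (k + 1) y)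
    with hQ
  -- Halving the time steps changes the prism sum by thin triangles along the two tracks. Each
  -- contribution depends on one point only, so subtracting it does not affect the coboundary, even
  -- at coarse levels where nothing is known about `c`.
  set e : ℕ → Y → ℝ := fun n x => ∑ k ∈ Finset.range (2 ^ n),
    c (pt n k x) (pt (n + 1) (2 * k + 1) x) (pt n (k + 1) x) with he
  obtain ⟨a, ha⟩ := exists_eventual_value fun (q : Y × Y) (n : ℕ) =>
    ∑ k ∈ Finset.range (2 ^ n), Q n k q.1 q.2 - ∑ m ∈ Finset.range n, e m q.2 +
      ∑ m ∈ Finset.range n, e m q.1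
  -- The end of the homotopy contributes `c b b b`, which need not vanish; a constant `2`-point
  -- cochain has that same constant as its coboundary.
  refine ⟨fun x y => a (x, y) + c b b b, fun p => ?_⟩
  obtain ⟨W, hW, n₀, hn₀⟩ := exists_dyadic_small hH hc p
  refine ⟨W, hW, ?_⟩
  have t0 : ∀ n k : ℕ, (k : ℝ) / 2 ^ n ∈ Set.Icc ((k : ℝ) / 2 ^ n) ((k + 1 : ℝ) / 2 ^ n) :=
    fun n k => ⟨le_rfl, by gcongr; linarith⟩
  have t1 : ∀ n k : ℕ,
      ((k + 1 : ℕ) : ℝ) / 2 ^ n ∈ Set.Icc ((k : ℝ) / 2 ^ n) ((k + 1 : ℝ) / 2 ^ n) :=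
    fun n k => ⟨by push_cast; gcongr; linarith, by push_cast; rfl⟩
  have tm : ∀ n k : ℕ, ((2 * k + 1 : ℕ) : ℝ) / 2 ^ (n + 1) ∈
      Set.Icc ((k : ℝ) / 2 ^ n) ((k + 1 : ℝ) / 2 ^ n) := by
    intro n k
    have hpos : (0 : ℝ) < 2 ^ n := by positivity
    rw [pow_succ]; push_cast
    constructor
    · rw [div_le_div_iff₀ hpos (by positivity)]; nlinarith
    · rw [div_le_div_iff₀ (by positivity) hpos]; nlinarith
  have hval : ∀ x ∈ W, ∀ y ∈ W, ∀ n ≥ n₀, a (x, y) =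
      ∑ k ∈ Finset.range (2 ^ n), Q n k x y - ∑ m ∈ Finset.range n, e m y +
        ∑ m ∈ Finset.range n, e m x := by
    intro x hx y hy
    refine ha (x, y) n₀ fun n hn => ?_
    have hstep : ∑ k ∈ Finset.range (2 ^ (n + 1)), Q (n + 1) k x y =
        ∑ k ∈ Finset.range (2 ^ n), Q n k x y + e n y - e n x := by
      rw [sum_range_two_pow_succ, ← Finset.sum_add_distrib, ← Finset.sum_sub_distrib]
      refine Finset.sum_congr rfl fun k hk => ?_
      obtain ⟨N, ⟨l, hl⟩, hN⟩ := hn₀ n hn k (Finset.mem_range.1 hk)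
      have e0 : ((2 * k : ℕ) : ℝ) / 2 ^ (n + 1) = k / 2 ^ n := by
        rw [pow_succ]; push_cast; field_simp
      have e2 : ((2 * k + 1 + 1 : ℕ) : ℝ) / 2 ^ (n + 1) = (k + 1 : ℕ) / 2 ^ n := by
        rw [pow_succ]; push_cast; field_simp; ring
      have x0 := hN x hx _ (t0 n k)
      have x1 := hN x hx _ (t1 n k)
      have xm := hN x hx _ (tm n k)
      have y0 := hN y hy _ (t0 n k)
      have y1 := hN y hy _ (t1 n k)
      have ym := hN y hy _ (tm n k)
      simp only [hQ, hpt, e0, e2]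
      rw [hl _ x0 _ y0 _ ym, hl _ x0 _ xm _ ym, hl _ xm _ ym _ y1, hl _ xm _ x1 _ y1,
        hl _ x0 _ y0 _ y1, hl _ x0 _ x1 _ y1, hl _ y0 _ ym _ y1, hl _ x0 _ xm _ x1]
      ring
    rw [hstep, Finset.sum_range_succ, Finset.sum_range_succ]
    ring
  intro x hx y hy z hz
  -- The boundary formula for the prism over the triangle `x, y, z`: the sides give the difference
  -- of bottom and top, which telescopes in `k`.
  have key : ∀ k ∈ Finset.range (2 ^ n₀),
      Q n₀ k x y + Q n₀ k y z - Q n₀ k x z =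
        c (pt n₀ k x) (pt n₀ k y) (pt n₀ k z) -
          c (pt n₀ (k + 1) x) (pt n₀ (k + 1) y) (pt n₀ (k + 1) z) := by
    intro k hk
    obtain ⟨N, ⟨l, hl⟩, hN⟩ := hn₀ n₀ le_rfl k (Finset.mem_range.1 hk)
    have x0 := hN x hx _ (t0 n₀ k)
    have x1 := hN x hx _ (t1 n₀ k)
    have y0 := hN y hy _ (t0 n₀ k)
    have y1 := hN y hy _ (t1 n₀ k)
    have z0 := hN z hz _ (t0 n₀ k)
    have z1 := hN z hz _ (t1 n₀ k)
    simp only [hQ, hpt]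
    rw [hl _ x0 _ y0 _ y1, hl _ x0 _ x1 _ y1, hl _ y0 _ z0 _ z1, hl _ y0 _ y1 _ z1,
      hl _ x0 _ z0 _ z1, hl _ x0 _ x1 _ z1, hl _ x0 _ y0 _ z0, hl _ x1 _ y1 _ z1]
    ring
  have htel := (Finset.sum_congr rfl key).trans (Finset.sum_range_sub' (fun k : ℕ =>
    c (pt n₀ k x) (pt n₀ k y) (pt n₀ k z)) (2 ^ n₀))
  have e1 : ((2 ^ n₀ : ℕ) : ℝ) / 2 ^ n₀ = 1 := by push_cast; exact div_self (by positivity)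
  rw [Finset.sum_sub_distrib, Finset.sum_add_distrib] at htel
  simp only [hpt, e1, H1, Nat.cast_zero, zero_div, H0] at htel
  dsimp only
  rw [hval x hx y hy n₀ le_rfl, hval y hy z hz n₀ le_rfl, hval x hx z hz n₀ le_rfl]
  linarith

end AlexanderSpanier

end GerbeTorus
end

noncomputable section
namespace GerbeTorus
set_option maxSynthPendingDepth 3

/-! ### The Poincaré lemma on a ball -/

section Poincare

open ContinuousAlternatingMap Topology

universe v

theorem hasFDerivAt_intervalIntegral_of_contDiff {E G : Type*} [NormedAddCommGroup E]
    [NormedSpace ℝ E] [FiniteDimensional ℝ E] [NormedAddCommGroup G] [NormedSpace ℝ G]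
    {F : E × ℝ → G} (hF : ContDiff ℝ 1 F) (x : E) :
    HasFDerivAt (fun x => ∫ t in (0 : ℝ)..1, F (x, t))
      (∫ t in (0 : ℝ)..1, (fderiv ℝ F (x, t)).comp (ContinuousLinearMap.inl ℝ E ℝ)) x := by
  have hcont : Continuous fun p : E × ℝ =>
      (fderiv ℝ F p).comp (ContinuousLinearMap.inl ℝ E ℝ) :=
    (hF.continuous_fderiv one_ne_zero).clm_comp continuous_const
  obtain ⟨C, hC⟩ := ((isCompact_closedBall x 1).prod
    (isCompact_Icc (a := (0 : ℝ)) (b := 1))).exists_bound_of_continuousOn hcont.continuousOn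
  refine intervalIntegral.hasFDerivAt_integral_of_dominated_of_fderiv_le
    (F := fun x t => F (x, t))
    (F' := fun x t => (fderiv ℝ F (x, t)).comp (ContinuousLinearMap.inl ℝ E ℝ))
    (bound := fun _ => C) (Metric.ball_mem_nhds x one_pos) ?_ ?_ ?_ ?_ ?_ ?_
  · exact Filter.Eventually.of_forall fun y =>
      (hF.continuous.comp (Continuous.prodMk_right y)).aestronglyMeasurable
  · exact (hF.continuous.comp (Continuous.prodMk_right x)).intervalIntegrable _ _
  · exact (hcont.comp (Continuous.prodMk_right x)).aestronglyMeasurable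
  · refine Filter.Eventually.of_forall fun t ht y hy => hC (y, t) ⟨Metric.ball_subset_closedBall hy, ?_⟩
    rw [Set.uIoc_of_le zero_le_one] at ht
    exact ⟨ht.1.le, ht.2⟩
  · exact intervalIntegrable_const
  · refine Filter.Eventually.of_forall fun t _ y _ => ?_
    exact ((hF.differentiable one_ne_zero) (y, t)).hasFDerivAt.comp y (hasFDerivAt_prodMk_left y t)

/-- Induction on the order of differentiability: the derivative is again an integral of this shape,
with values in `E →L[ℝ] G`, so the target space has to vary in the induction. -/
theorem contDiff_intervalIntegral {E G : Type v} [NormedAddCommGroup E] [NormedSpace ℝ E]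
    [FiniteDimensional ℝ E] [NormedAddCommGroup G] [NormedSpace ℝ G]
    {F : E × ℝ → G} (hF : ContDiff ℝ ∞ F) :
    ContDiff ℝ ∞ fun x => ∫ t in (0 : ℝ)..1, F (x, t) := by
  refine contDiff_infty.2 fun n => ?_
  induction n generalizing G with
  | zero =>
    exact contDiff_zero.2 (continuous_iff_continuousAt.2 fun x =>
      (hasFDerivAt_intervalIntegral_of_contDiff (hF.of_le (by simp)) x).continuousAt)
  | succ n ih =>
    push_cast
    refine contDiff_succ_iff_fderiv.2 ⟨fun x =>
      (hasFDerivAt_intervalIntegral_of_contDiff (hF.of_le (by simp)) x).differentiableAt,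
      by simp, ?_⟩
    have : fderiv ℝ (fun x => ∫ t in (0 : ℝ)..1, F (x, t)) = fun x =>
        ∫ t in (0 : ℝ)..1, (fderiv ℝ F (x, t)).comp (ContinuousLinearMap.inl ℝ E ℝ) :=
      funext fun x => (hasFDerivAt_intervalIntegral_of_contDiff (hF.of_le (by simp)) x).fderiv
    rw [this]
    exact ih (F := fun p => (fderiv ℝ F p).comp (ContinuousLinearMap.inl ℝ E ℝ))
      ((hF.fderiv_right (by simp)).clm_comp contDiff_const)

variable {E : Type v} [NormedAddCommGroup E] [NormedSpace ℝ E]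

/-- The algebraic core of Cartan's formula at a point, with `D` the derivative of a form and `w`
held constant: in the alternating sum for `D` evaluated at `w, v`, the first term is `D w` and the
others are, up to sign, the alternatization of `L`. -/
theorem alternatizeUncurryFin_curryLeft_apply {k : ℕ} (D : E →L[ℝ] E [⋀^Fin (k + 1)]→L[ℝ] ℝ)
    (w : E) (L : E →L[ℝ] E [⋀^Fin k]→L[ℝ] ℝ) (hL : ∀ v, L v = (D v).curryLeft w) :
    alternatizeUncurryFin L = D w - (alternatizeUncurryFin D).curryLeft w := by
  ext v
  have h : ∀ i : Fin (k + 1), (i.succ).removeNth (Fin.cons w v : Fin (k + 2) → E) =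
      Fin.cons w (i.removeNth v) := by
    intro i
    ext j
    refine Fin.cases ?_ (fun j => ?_) j <;> simp [Fin.removeNth]
  rw [ContinuousAlternatingMap.sub_apply, curryLeft_apply_apply,
    alternatizeUncurryFin_apply, alternatizeUncurryFin_apply, Fin.sum_univ_succ (n := k + 1)]
  simp only [Matrix.vecCons, h, hL, Fin.cons_zero, Fin.cons_succ, Fin.val_succ, pow_succ,
    mul_neg_one, neg_smul, Finset.sum_neg_distrib, Fin.removeNth_zero, Fin.tail_cons, Fin.val_zero,
    pow_zero, one_smul, curryLeft_apply_apply]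
  abel

variable [FiniteDimensional ℝ E]

theorem exists_extDeriv_eq_of_contDiff {k : ℕ} {β : E → E [⋀^Fin (k + 1)]→L[ℝ] ℝ}
    (hβ : ContDiff ℝ ∞ β) {y₀ : E} {r : ℝ} (hcl : ∀ y ∈ Metric.ball y₀ r, extDeriv β y = 0) :
    ∃ η : E → E [⋀^Fin k]→L[ℝ] ℝ, ContDiff ℝ ∞ η ∧
      ∀ y ∈ Metric.ball y₀ r, extDeriv η y = β y := by
  set CL := (curryLeftLI (𝕜 := ℝ) (E := E) (F := ℝ) (n := k)).toContinuousLinearMap with hCL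
  -- The integrand of the radial homotopy operator, `t^k ι_{x - y₀} β(y₀ + t(x - y₀))`.
  set F : E × ℝ → E [⋀^Fin k]→L[ℝ] ℝ := fun p =>
    p.2 ^ k • CL (β (y₀ + p.2 • (p.1 - y₀))) (p.1 - y₀) with hF
  have hFs : ContDiff ℝ ∞ F := by
    have h0 : ContDiff ℝ ∞ fun p : E × ℝ => y₀ + p.2 • (p.1 - y₀) :=
      contDiff_const.add (contDiff_snd.smul (contDiff_fst.sub contDiff_const))
    have h1 : ContDiff ℝ ∞ fun p : E × ℝ => CL (β (y₀ + p.2 • (p.1 - y₀))) :=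
      CL.contDiff.comp (hβ.comp h0)
    exact (contDiff_snd.pow k).smul (h1.clm_apply (contDiff_fst.sub contDiff_const))
  refine ⟨fun x => ∫ t in (0 : ℝ)..1, F (x, t), contDiff_intervalIntegral hFs, fun y hy => ?_⟩
  have hFs1 : ContDiff ℝ 1 F := hFs.of_le (by simp)
  have hii : IntervalIntegrable (fun t => (fderiv ℝ F (y, t)).comp (ContinuousLinearMap.inl ℝ E ℝ))
      MeasureTheory.volume 0 1 :=
    (((hFs1.continuous_fderiv one_ne_zero).comp (Continuous.prodMk_right y)).clm_comp
      continuous_const).intervalIntegrable _ _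
  rw [extDeriv, (hasFDerivAt_intervalIntegral_of_contDiff hFs1 y).fderiv,
    ← alternatizeUncurryFinCLM_apply,
    ← ContinuousLinearMap.intervalIntegral_comp_comm (alternatizeUncurryFinCLM ℝ E ℝ) hii]
  have hγ : ∀ t : ℝ, HasDerivAt (fun t : ℝ => y₀ + t • (y - y₀)) (y - y₀) t := by
    intro t
    simpa using ((hasDerivAt_id t).smul_const (y - y₀)).const_add y₀
  have hder : ∀ t : ℝ, HasDerivAt (fun t : ℝ => t ^ (k + 1) • β (y₀ + t • (y - y₀)))
      (t ^ (k + 1) • fderiv ℝ β (y₀ + t • (y - y₀)) (y - y₀) +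
        (((k + 1 : ℕ) : ℝ) * t ^ k) • β (y₀ + t • (y - y₀))) t := by
    intro t
    have h1 := ((hβ.differentiable (by simp)) (y₀ + t • (y - y₀))).hasFDerivAt.comp_hasDerivAt t
      (hγ t)
    have h2 := (hasDerivAt_pow (k + 1) t).smul h1
    rw [Nat.add_sub_cancel] at h2
    exact h2
  -- Since `dβ = 0` along the ray, the exterior derivative of the integrand is the `t`-derivative of
  -- `t^(k+1) β(y₀ + t(y - y₀))`, whose integral over `[0,1]` is `β y`.
  have hint : ∀ t ∈ Set.uIcc (0 : ℝ) 1,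
      alternatizeUncurryFinCLM ℝ E ℝ
        ((fderiv ℝ F (y, t)).comp (ContinuousLinearMap.inl ℝ E ℝ)) =
      t ^ (k + 1) • fderiv ℝ β (y₀ + t • (y - y₀)) (y - y₀) +
        (((k + 1 : ℕ) : ℝ) * t ^ k) • β (y₀ + t • (y - y₀)) := by
    intro t ht
    rw [Set.uIcc_of_le zero_le_one] at ht
    set z := y₀ + t • (y - y₀) with hz
    have hzmem : z ∈ Metric.ball y₀ r := by
      rw [mem_ball_iff_norm, hz, add_sub_cancel_left, norm_smul, Real.norm_of_nonneg ht.1]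
      rw [mem_ball_iff_norm] at hy
      exact (mul_le_of_le_one_left (norm_nonneg _) ht.2).trans_lt hy
    have h1 : HasFDerivAt (fun x : E => F (x, t))
        ((fderiv ℝ F (y, t)).comp (ContinuousLinearMap.inl ℝ E ℝ)) y := by
      exact ((hFs1.differentiable one_ne_zero) (y, t)).hasFDerivAt.comp (f := fun x => (x, t)) y
        (hasFDerivAt_prodMk_left y t)
    have h2 : HasFDerivAt (fun x : E => y₀ + t • (x - y₀)) (t • ContinuousLinearMap.id ℝ E) y :=
      (((hasFDerivAt_id y).sub_const y₀).const_smul t).const_add y₀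
    have h3 : HasFDerivAt (fun x : E => CL (β (y₀ + t • (x - y₀))))
        (CL.comp ((fderiv ℝ β z).comp (t • ContinuousLinearMap.id ℝ E))) y :=
      CL.hasFDerivAt.comp y
        (((hβ.differentiable (by simp)) z).hasFDerivAt.comp y h2)
    have h4 := (h3.clm_apply ((hasFDerivAt_id y).sub_const y₀)).const_smul (t ^ k)
    rw [h1.unique h4]
    set L : E →L[ℝ] E [⋀^Fin k]→L[ℝ] ℝ := (CL.comp (fderiv ℝ β z)).flip (y - y₀) with hLdef
    have hL := alternatizeUncurryFin_curryLeft_apply (fderiv ℝ β z) (y - y₀) L (fun v => rfl)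
    have hcl' := hcl z hzmem
    rw [extDeriv] at hcl'
    have h0 : (0 : E [⋀^Fin (k + 1 + 1)]→L[ℝ] ℝ).curryLeft (y - y₀) = 0 := by
      ext; simp
    rw [hcl', h0, sub_zero] at hL
    have hM := alternatizeUncurryFin_curryLeft (β z)
    -- Product rule: differentiating the contracted vector gives `(β z).curryLeft`, with
    -- alternatization `(k + 1) β z`; differentiating `β` brings out one more factor `t`.
    have hsplit : t ^ k • ((CL (β z)).comp (ContinuousLinearMap.id ℝ E) +
        (CL.comp ((fderiv ℝ β z).comp (t • ContinuousLinearMap.id ℝ E))).flip (id y - y₀)) =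
        t ^ k • (β z).curryLeft + t ^ (k + 1) • L := by
      ext v
      simp [hLdef, hCL, pow_succ, mul_assoc]
    rw [hsplit, map_add, map_smul, map_smul, alternatizeUncurryFinCLM_apply,
      alternatizeUncurryFinCLM_apply, hL, hM, add_comm (t ^ k • _), mul_comm (((k + 1 : ℕ) : ℝ)) (t ^ k), mul_smul,
      Nat.cast_smul_eq_nsmul]
  rw [intervalIntegral.integral_congr hint,
    intervalIntegral.integral_eq_sub_of_hasDerivAt fun t _ => hder t]
  · simp
  · refine Continuous.intervalIntegrable ?_ _ _
    have hc : Continuous fun t : ℝ => y₀ + t • (y - y₀) := by fun_prop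
    have hβ' := hβ.continuous_fderiv (by simp)
    have hβ'' := hβ.continuous
    fun_prop

/-- The Poincaré lemma for forms that are closed on a ball. -/
theorem exists_extDeriv_eq_of_contDiffOn {k : ℕ} {β : E → E [⋀^Fin (k + 1)]→L[ℝ] ℝ} {y₀ : E}
    {r : ℝ} (hr : 0 < r) (hβ : ContDiffOn ℝ ∞ β (Metric.ball y₀ r))
    (hcl : ∀ y ∈ Metric.ball y₀ r, extDeriv β y = 0) :
    ∃ η : E → E [⋀^Fin k]→L[ℝ] ℝ, ContDiff ℝ ∞ η ∧
      ∃ ρ > 0, ρ ≤ r ∧ ∀ y ∈ Metric.ball y₀ ρ, extDeriv η y = β y := by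
  -- A cutoff extends the form smoothly to the whole space. It equals `1` on the ball of radius `r /
  -- 3`, where closedness survives.
  let χ : ContDiffBump y₀ := ⟨r / 3, r / 2, by linarith, by linarith⟩
  have hs : ContDiff ℝ ∞ fun y => χ y • β y := by
    refine contDiff_iff_contDiffAt.2 fun y => ?_
    by_cases hy : y ∈ Metric.ball y₀ r
    · exact χ.contDiffAt.smul (hβ.contDiffAt (Metric.isOpen_ball.mem_nhds hy))
    · have : (fun y => χ y • β y) =ᶠ[𝓝 y] fun _ => 0 := by
        have hy' : y ∈ (Metric.closedBall y₀ (r / 2))ᶜ := fun h =>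
          hy (Metric.closedBall_subset_ball (by linarith) h)
        filter_upwards [Metric.isClosed_closedBall.isOpen_compl.mem_nhds hy'] with z hz
        have : χ z = 0 := χ.zero_of_le_dist (by
          simpa [χ] using (not_le.1 (fun h => hz (Metric.mem_closedBall.2 h))).le)
        rw [this, zero_smul]
      exact contDiffAt_const.congr_of_eventuallyEq this
  have heq : ∀ y ∈ Metric.ball y₀ (r / 3), (fun y => χ y • β y) =ᶠ[𝓝 y] β := by
    intro y hy
    filter_upwards [Metric.isOpen_ball.mem_nhds hy] with z hz
    have : χ z = 1 := χ.one_of_mem_closedBall (Metric.ball_subset_closedBall hz)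
    simp only [this, one_smul]
  obtain ⟨η, hη, h⟩ := exists_extDeriv_eq_of_contDiff hs (y₀ := y₀) (r := r / 3) fun y hy => by
    rw [(heq y hy).extDeriv_eq]
    exact hcl y (Metric.ball_subset_ball (by linarith) hy)
  exact ⟨η, hη, r / 3, by linarith, by linarith, fun y hy => by
    rw [h y hy]; exact (heq y hy).self_of_nhds⟩

end Poincare

end GerbeTorus
end

noncomputable section
namespace GerbeTorus
set_option maxSynthPendingDepth 3

/-! ### Smooth families of alternating maps -/

section FiniteDimensional

variable {D E E' : Type*} [NormedAddCommGroup D] [NormedSpace ℝ D] [NormedAddCommGroup E]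
  [NormedSpace ℝ E] [FiniteDimensional ℝ E] [NormedAddCommGroup E'] [NormedSpace ℝ E']
  [FiniteDimensional ℝ E']

theorem finiteDimensional_continuousAlternatingMap (k : ℕ) :
    FiniteDimensional ℝ (E [⋀^Fin k]→L[ℝ] ℝ) := by
  let T : (E [⋀^Fin k]→L[ℝ] ℝ) →ₗ[ℝ] MultilinearMap ℝ (fun _ : Fin k => E) ℝ :=
    { toFun := fun f => f.toMultilinearMap
      map_add' := fun f g => rfl
      map_smul' := fun c f => rfl }
  refine FiniteDimensional.of_injective T fun f g h => ?_
  ext v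
  exact congrArg (fun m : MultilinearMap ℝ (fun _ : Fin k => E) ℝ => m v) h

/-- Evaluation on tuples of basis vectors embeds the alternating maps linearly in a
finite-dimensional coordinate space, and a linear left inverse recovers `f` smoothly from its
coordinates. -/
theorem contDiffAt_continuousAlternatingMap {k : ℕ} {n : WithTop ℕ∞}
    {f : D → E [⋀^Fin k]→L[ℝ] ℝ} {x : D} (h : ∀ v, ContDiffAt ℝ n (fun y => f y v) x) :
    ContDiffAt ℝ n f x := by
  have := finiteDimensional_continuousAlternatingMap (E := E) k
  let b := Module.finBasis ℝ E
  let T : (E [⋀^Fin k]→L[ℝ] ℝ) →ₗ[ℝ] ((Fin k → Fin (Module.finrank ℝ E)) → ℝ) :=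
    { toFun := fun f s => f fun j => b (s j)
      map_add' := fun f g => rfl
      map_smul' := fun c f => rfl }
  have hT : LinearMap.ker T = ⊥ := LinearMap.ker_eq_bot.2 fun f g hfg =>
    ContinuousAlternatingMap.toAlternatingMap_injective
      (Module.Basis.ext_alternating b fun s _ => congrFun hfg s)
  obtain ⟨L, hL⟩ := T.exists_leftInverse_of_injective hT
  have hf : f = fun y => LinearMap.toContinuousLinearMap L (T (f y)) :=
    funext fun y => (LinearMap.congr_fun hL (f y)).symm
  rw [hf]
  exact (LinearMap.toContinuousLinearMap L).contDiff.contDiffAt.comp x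
    (contDiffAt_pi.2 fun s => h _)

theorem contDiffAt_compContinuousLinearMap {k : ℕ} {n : WithTop ℕ∞}
    {f : D → E [⋀^Fin k]→L[ℝ] ℝ} {A : D → E' →L[ℝ] E} {x : D} (hf : ContDiffAt ℝ n f x)
    (hA : ContDiffAt ℝ n A x) :
    ContDiffAt ℝ n (fun y => (f y).compContinuousLinearMap (A y)) x := by
  have := finiteDimensional_continuousAlternatingMap (E := E) k
  refine contDiffAt_continuousAlternatingMap fun v => ?_
  let b := Module.finBasis ℝ (E [⋀^Fin k]→L[ℝ] ℝ)
  have hexp : ∀ y, (f y).compContinuousLinearMap (A y) v =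
      ∑ i, b.repr (f y) i • (b i).toContinuousMultilinearMap fun j => A y (v j) := by
    intro y
    have h := congrArg (fun F : E [⋀^Fin k]→L[ℝ] ℝ => F (A y ∘ v)) (b.sum_repr (f y))
    simp only [ContinuousAlternatingMap.sum_apply, ContinuousAlternatingMap.smul_apply] at h
    exact h.symm
  simp only [hexp]
  refine ContDiffAt.sum fun i _ => ContDiffAt.fun_smul ?_ ?_
  · exact (LinearMap.toContinuousLinearMap (b.coord i)).contDiff.contDiffAt.comp x hf
  · exact (b i).toContinuousMultilinearMap.contDiff.contDiffAt.comp x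
      (contDiffAt_pi.2 fun j => hA.clm_apply contDiffAt_const)

end FiniteDimensional

/-! ### Differentials of charts and their inverses -/

section Charts

open Topology

variable {d : ℕ} {X : Type*} [TopologicalSpace X] [ChartedSpace (EuclideanSpace ℝ (Fin d)) X]

theorem extChartAt_symm_mem_source {x₀ : X} {y : EuclideanSpace ℝ (Fin d)}
    (hy : y ∈ (extChartAt (𝓡 d) x₀).target) :
    (extChartAt (𝓡 d) x₀).symm y ∈ (chartAt (EuclideanSpace ℝ (Fin d)) x₀).source := by
  simpa using (extChartAt (𝓡 d) x₀).map_target hy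

theorem extChartAt_mem_target {x₀ x : X}
    (hx : x ∈ (chartAt (EuclideanSpace ℝ (Fin d)) x₀).source) :
    extChartAt (𝓡 d) x₀ x ∈ (extChartAt (𝓡 d) x₀).target :=
  (extChartAt (𝓡 d) x₀).map_source (by simpa using hx)

theorem extChartAt_symm_apply {x₀ x : X}
    (hx : x ∈ (chartAt (EuclideanSpace ℝ (Fin d)) x₀).source) :
    (extChartAt (𝓡 d) x₀).symm (extChartAt (𝓡 d) x₀ x) = x :=
  (extChartAt (𝓡 d) x₀).left_inv (by simpa using hx)

theorem extChartAt_target_mem_nhds_of_mem {x₀ : X} {y : EuclideanSpace ℝ (Fin d)}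
    (hy : y ∈ (extChartAt (𝓡 d) x₀).target) : (extChartAt (𝓡 d) x₀).target ∈ 𝓝 y :=
  (isOpen_extChartAt_target x₀).mem_nhds hy

variable [IsManifold (𝓡 d) ∞ X]

theorem contMDiffAt_extChartAt_symm {x₀ : X} {y : EuclideanSpace ℝ (Fin d)}
    (hy : y ∈ (extChartAt (𝓡 d) x₀).target) :
    ContMDiffAt 𝓘(ℝ, EuclideanSpace ℝ (Fin d)) (𝓡 d) ∞ (extChartAt (𝓡 d) x₀).symm y :=
  (contMDiffOn_extChartAt_symm x₀).contMDiffAt (extChartAt_target_mem_nhds_of_mem hy)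

theorem mdifferentiableAt_extChartAt_symm {x₀ : X} {y : EuclideanSpace ℝ (Fin d)}
    (hy : y ∈ (extChartAt (𝓡 d) x₀).target) :
    MDifferentiableAt 𝓘(ℝ, EuclideanSpace ℝ (Fin d)) (𝓡 d) (extChartAt (𝓡 d) x₀).symm y :=
  (contMDiffAt_extChartAt_symm hy).mdifferentiableAt (by simp)

theorem mdifferentiableAt_extChartAt' {x₀ x : X}
    (hx : x ∈ (chartAt (EuclideanSpace ℝ (Fin d)) x₀).source) :
    MDifferentiableAt (𝓡 d) 𝓘(ℝ, EuclideanSpace ℝ (Fin d)) (extChartAt (𝓡 d) x₀) x :=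
  (contMDiffAt_extChartAt' (n := ∞) hx).mdifferentiableAt (by simp)

theorem continuousAt_extChartAt_symm_of_mem {x₀ : X} {y : EuclideanSpace ℝ (Fin d)}
    (hy : y ∈ (extChartAt (𝓡 d) x₀).target) : ContinuousAt (extChartAt (𝓡 d) x₀).symm y :=
  (contMDiffAt_extChartAt_symm hy).continuousAt

/-- Close points of a chart correspond to close points of the manifold. -/
theorem eventually_extChartAt_symm {x₀ : X} {y : EuclideanSpace ℝ (Fin d)}
    (hy : y ∈ (extChartAt (𝓡 d) x₀).target) {p : X → Prop}
    (hp : ∀ᶠ x in 𝓝 ((extChartAt (𝓡 d) x₀).symm y), p x) :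
    ∀ᶠ z in 𝓝 y, z ∈ (extChartAt (𝓡 d) x₀).target ∧ p ((extChartAt (𝓡 d) x₀).symm z) :=
  (Filter.eventually_mem_set.2 (extChartAt_target_mem_nhds_of_mem hy)).and
    ((continuousAt_extChartAt_symm_of_mem hy).eventually hp)

/-- A map between manifolds in two charts. -/
theorem mfderiv_extChartAt_symm_comp_fderiv {g : X → X} {x₀ x₁ : X}
    {y : EuclideanSpace ℝ (Fin d)} (hy : y ∈ (extChartAt (𝓡 d) x₁).target)
    (hg : MDifferentiableAt (𝓡 d) (𝓡 d) g ((extChartAt (𝓡 d) x₁).symm y))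
    (hgs : g ((extChartAt (𝓡 d) x₁).symm y) ∈ (chartAt (EuclideanSpace ℝ (Fin d)) x₀).source) :
    (mfderiv 𝓘(ℝ, EuclideanSpace ℝ (Fin d)) (𝓡 d) (extChartAt (𝓡 d) x₀).symm
      (extChartAt (𝓡 d) x₀ (g ((extChartAt (𝓡 d) x₁).symm y)))).comp
      (fderiv ℝ (extChartAt (𝓡 d) x₀ ∘ g ∘ (extChartAt (𝓡 d) x₁).symm) y) =
    (mfderiv (𝓡 d) (𝓡 d) g ((extChartAt (𝓡 d) x₁).symm y)).comp
      (mfderiv 𝓘(ℝ, EuclideanSpace ℝ (Fin d)) (𝓡 d) (extChartAt (𝓡 d) x₁).symm y) := by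
  have h1 := mdifferentiableAt_extChartAt_symm hy
  have h2 : MDifferentiableAt 𝓘(ℝ, EuclideanSpace ℝ (Fin d)) (𝓡 d)
      (g ∘ (extChartAt (𝓡 d) x₁).symm) y := hg.comp y h1
  have h3 : MDifferentiableAt 𝓘(ℝ, EuclideanSpace ℝ (Fin d)) 𝓘(ℝ, EuclideanSpace ℝ (Fin d))
      (extChartAt (𝓡 d) x₀ ∘ g ∘ (extChartAt (𝓡 d) x₁).symm) y :=
    (mdifferentiableAt_extChartAt' hgs).comp y h2
  have h4 : MDifferentiableAt 𝓘(ℝ, EuclideanSpace ℝ (Fin d)) (𝓡 d) (extChartAt (𝓡 d) x₀).symm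
      ((extChartAt (𝓡 d) x₀ ∘ g ∘ (extChartAt (𝓡 d) x₁).symm) y) :=
    mdifferentiableAt_extChartAt_symm (extChartAt_mem_target hgs)
  have h5 : (extChartAt (𝓡 d) x₀).symm ∘ (extChartAt (𝓡 d) x₀ ∘ g ∘ (extChartAt (𝓡 d) x₁).symm)
      =ᶠ[𝓝 y] g ∘ (extChartAt (𝓡 d) x₁).symm := by
    filter_upwards [h2.continuousAt.preimage_mem_nhds
      ((chartAt (EuclideanSpace ℝ (Fin d)) x₀).open_source.mem_nhds hgs)] with z hz
    exact extChartAt_symm_apply hz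
  have h6 := mfderiv_comp y h4 h3
  rw [h5.mfderiv_eq, mfderiv_comp y hg h1, mfderiv_eq_fderiv] at h6
  exact h6.symm

theorem mfderiv_symm_comp_mfderiv_extChartAt {x₀ x : X}
    (hx : x ∈ (chartAt (EuclideanSpace ℝ (Fin d)) x₀).source) :
    (mfderiv 𝓘(ℝ, EuclideanSpace ℝ (Fin d)) (𝓡 d) (extChartAt (𝓡 d) x₀).symm
      (extChartAt (𝓡 d) x₀ x)).comp
      (mfderiv (𝓡 d) 𝓘(ℝ, EuclideanSpace ℝ (Fin d)) (extChartAt (𝓡 d) x₀) x) =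
    ContinuousLinearMap.id ℝ (EuclideanSpace ℝ (Fin d)) := by
  have h5 : (extChartAt (𝓡 d) x₀).symm ∘ extChartAt (𝓡 d) x₀ =ᶠ[𝓝 x] id := by
    filter_upwards [(chartAt (EuclideanSpace ℝ (Fin d)) x₀).open_source.mem_nhds hx] with z hz
    exact extChartAt_symm_apply hz
  have h6 := mfderiv_comp x (mdifferentiableAt_extChartAt_symm (extChartAt_mem_target hx))
    (mdifferentiableAt_extChartAt' hx)
  rw [h5.mfderiv_eq, mfderiv_id] at h6
  exact h6.symm

theorem mfderiv_comp_mfderiv_extChartAt_symm {x₀ : X} {y : EuclideanSpace ℝ (Fin d)}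
    (hy : y ∈ (extChartAt (𝓡 d) x₀).target) :
    (mfderiv (𝓡 d) 𝓘(ℝ, EuclideanSpace ℝ (Fin d)) (extChartAt (𝓡 d) x₀)
      ((extChartAt (𝓡 d) x₀).symm y)).comp
      (mfderiv 𝓘(ℝ, EuclideanSpace ℝ (Fin d)) (𝓡 d) (extChartAt (𝓡 d) x₀).symm y) =
    ContinuousLinearMap.id ℝ (EuclideanSpace ℝ (Fin d)) := by
  have h5 : extChartAt (𝓡 d) x₀ ∘ (extChartAt (𝓡 d) x₀).symm =ᶠ[𝓝 y] id := by
    filter_upwards [extChartAt_target_mem_nhds_of_mem hy] with z hz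
    exact (extChartAt (𝓡 d) x₀).right_inv hz
  have h6 := mfderiv_comp y (mdifferentiableAt_extChartAt' (extChartAt_symm_mem_source hy))
    (mdifferentiableAt_extChartAt_symm hy)
  rw [h5.mfderiv_eq, mfderiv_id] at h6
  exact h6.symm

end Charts

/-! ### Differential forms in charts -/

section FormCalculus

open Topology

variable {d k : ℕ} {X : Type*} [TopologicalSpace X] [ChartedSpace (EuclideanSpace ℝ (Fin d)) X]

/-- The value of a form at a point, as an alternating map on the model space. -/
def Form.val (η : Form d X k) (x : X) : EuclideanSpace ℝ (Fin d) [⋀^Fin k]→L[ℝ] ℝ := η x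

theorem Form.inChart_def (η : Form d X k) (x₀ : X) (y : EuclideanSpace ℝ (Fin d)) :
    η.inChart x₀ y = (η.val ((extChartAt (𝓡 d) x₀).symm y)).compContinuousLinearMap
      (mfderiv 𝓘(ℝ, EuclideanSpace ℝ (Fin d)) (𝓡 d) (extChartAt (𝓡 d) x₀).symm y) := rfl

theorem Form.inChart_extChartAt (η : Form d X k) {x₀ x : X}
    (hx : x ∈ (chartAt (EuclideanSpace ℝ (Fin d)) x₀).source) :
    η.inChart x₀ (extChartAt (𝓡 d) x₀ x) = (η.val x).compContinuousLinearMap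
      (mfderiv 𝓘(ℝ, EuclideanSpace ℝ (Fin d)) (𝓡 d) (extChartAt (𝓡 d) x₀).symm
        (extChartAt (𝓡 d) x₀ x)) := by
  rw [Form.inChart_def, extChartAt_symm_apply hx]

theorem Form.pullback_inChart [IsManifold (𝓡 d) ∞ X] (η : Form d X k) {g : X → X} {x₀ x₁ : X}
    {y : EuclideanSpace ℝ (Fin d)} (hy : y ∈ (extChartAt (𝓡 d) x₁).target)
    (hg : MDifferentiableAt (𝓡 d) (𝓡 d) g ((extChartAt (𝓡 d) x₁).symm y))
    (hgs : g ((extChartAt (𝓡 d) x₁).symm y) ∈ (chartAt (EuclideanSpace ℝ (Fin d)) x₀).source) :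
    (η.pullback g).inChart x₁ y =
      (η.inChart x₀ ((extChartAt (𝓡 d) x₀ ∘ g ∘ (extChartAt (𝓡 d) x₁).symm) y)).compContinuousLinearMap
        (fderiv ℝ (extChartAt (𝓡 d) x₀ ∘ g ∘ (extChartAt (𝓡 d) x₁).symm) y) := by
  have h := mfderiv_extChartAt_symm_comp_fderiv hy hg hgs
  ext v
  have h2 := η.inChart_extChartAt hgs
  simp only [Function.comp_apply] at h2 ⊢
  rw [h2]
  have h3 : ∀ j, mfderiv 𝓘(ℝ, EuclideanSpace ℝ (Fin d)) (𝓡 d) (extChartAt (𝓡 d) x₀).symm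
      (extChartAt (𝓡 d) x₀ (g ((extChartAt (𝓡 d) x₁).symm y)))
      (fderiv ℝ (extChartAt (𝓡 d) x₀ ∘ g ∘ (extChartAt (𝓡 d) x₁).symm) y (v j)) =
      mfderiv (𝓡 d) (𝓡 d) g ((extChartAt (𝓡 d) x₁).symm y)
        (mfderiv 𝓘(ℝ, EuclideanSpace ℝ (Fin d)) (𝓡 d) (extChartAt (𝓡 d) x₁).symm y (v j)) :=
    fun j => congrArg (fun L => L (v j)) h
  exact (congrArg (η.val (g ((extChartAt (𝓡 d) x₁).symm y))) (funext h3)).symm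

theorem Form.val_eq_inChart_comp [IsManifold (𝓡 d) ∞ X] (η : Form d X k) {x₀ x : X}
    (hx : x ∈ (chartAt (EuclideanSpace ℝ (Fin d)) x₀).source) :
    η.val x = (η.inChart x₀ (extChartAt (𝓡 d) x₀ x)).compContinuousLinearMap
      (mfderiv (𝓡 d) 𝓘(ℝ, EuclideanSpace ℝ (Fin d)) (extChartAt (𝓡 d) x₀) x) := by
  have h := mfderiv_symm_comp_mfderiv_extChartAt hx
  ext v
  rw [η.inChart_extChartAt hx]
  have h3 : ∀ j, v j = mfderiv 𝓘(ℝ, EuclideanSpace ℝ (Fin d)) (𝓡 d) (extChartAt (𝓡 d) x₀).symm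
      (extChartAt (𝓡 d) x₀ x)
      (mfderiv (𝓡 d) 𝓘(ℝ, EuclideanSpace ℝ (Fin d)) (extChartAt (𝓡 d) x₀) x (v j)) :=
    fun j => (congrArg (fun L => L (v j)) h).symm
  exact congrArg (η.val x) (funext h3)

end FormCalculus

end GerbeTorus
end

noncomputable section
namespace GerbeTorus
set_option maxSynthPendingDepth 3

/-! ### Smoothness and exterior derivative on the manifold -/

section FormCalculus

open Topology

variable {d k : ℕ} {X : Type*} [TopologicalSpace X] [ChartedSpace (EuclideanSpace ℝ (Fin d)) X]

theorem Form.inChart_congr {η η' : Form d X k} {x₀ x : X}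
    (h : ∀ᶠ z in 𝓝 x, η z = η' z) [IsManifold (𝓡 d) ∞ X]
    (hx : x ∈ (chartAt (EuclideanSpace ℝ (Fin d)) x₀).source) :
    η.inChart x₀ =ᶠ[𝓝 (extChartAt (𝓡 d) x₀ x)] η'.inChart x₀ := by
  rw [← extChartAt_symm_apply hx] at h
  filter_upwards [eventually_extChartAt_symm (extChartAt_mem_target hx) h] with y hy
  rw [Form.inChart_def, Form.inChart_def, Form.val, Form.val, hy.2]

theorem Form.inChart_add (η η' : Form d X k) (x₀ : X) :
    (η + η').inChart x₀ = η.inChart x₀ + η'.inChart x₀ := rfl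

theorem Form.inChart_neg (η : Form d X k) (x₀ : X) : (-η).inChart x₀ = -η.inChart x₀ := rfl

theorem Form.extd_congr {η η' : Form d X k} {x : X} [IsManifold (𝓡 d) ∞ X]
    (h : ∀ᶠ z in 𝓝 x, η z = η' z) : η.extd x = η'.extd x := by
  rw [Form.extd, Form.extd,
    (Form.inChart_congr h (mem_chart_source (EuclideanSpace ℝ (Fin d)) x)).extDeriv_eq]

/-- Smoothness of a form at a point. -/
def Form.SmoothAt (η : Form d X k) (x : X) : Prop :=
  ContDiffAt ℝ ∞ (η.inChart x) (extChartAt (𝓡 d) x x)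

theorem Form.SmoothAt.add {η η' : Form d X k} {x : X} (h : η.SmoothAt x) (h' : η'.SmoothAt x) :
    (η + η').SmoothAt x := ContDiffAt.add h h'

theorem Form.SmoothAt.sub {η η' : Form d X k} {x : X} (h : η.SmoothAt x) (h' : η'.SmoothAt x) :
    (η - η').SmoothAt x := ContDiffAt.sub h h'

theorem Form.SmoothAt.extd_add {η η' : Form d X k} {x : X} (h : η.SmoothAt x)
    (h' : η'.SmoothAt x) : (η + η').extd x = η.extd x + η'.extd x := by
  rw [Form.extd, Form.inChart_add,
    extDeriv_add (h.differentiableAt (by simp)) (h'.differentiableAt (by simp))]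
  rfl

theorem Form.extd_neg (η : Form d X k) (x : X) : (-η).extd x = -η.extd x := by
  have h : (-η).inChart x = (-1 : ℝ) • η.inChart x := by rw [Form.inChart_neg, neg_one_smul]
  rw [Form.extd, h, extDeriv_smul, neg_one_smul]
  rfl

theorem Form.SmoothAt.neg {η : Form d X k} {x : X} (h : η.SmoothAt x) : (-η).SmoothAt x :=
  ContDiffAt.neg h

theorem Form.SmoothAt.extd_sub {η η' : Form d X k} {x : X} (h : η.SmoothAt x)
    (h' : η'.SmoothAt x) : (η - η').extd x = η.extd x - η'.extd x := by
  rw [sub_eq_add_neg, h.extd_add h'.neg, Form.extd_neg, ← sub_eq_add_neg]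

theorem Form.pullback_id (η : Form d X k) : η.pullback id = η := by
  ext x v
  rw [Form.pullback, mfderiv_id]
  rfl

/-- Every `0`-form is a function. -/
theorem Form.exists_eq_ofFun (η : Form d X 0) : ∃ u : X → ℝ, η = Form.ofFun d u := by
  refine ⟨fun x => η.val x 0, ?_⟩
  ext x v
  rw [Form.ofFun]
  exact congrArg (η.val x) (Subsingleton.elim _ _)

variable [IsManifold (𝓡 d) ∞ X]

theorem Form.inChart_change (η : Form d X k) {x₀ x₁ : X} {y : EuclideanSpace ℝ (Fin d)}
    (hy : y ∈ (extChartAt (𝓡 d) x₁).target)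
    (hy' : (extChartAt (𝓡 d) x₁).symm y ∈ (chartAt (EuclideanSpace ℝ (Fin d)) x₀).source) :
    η.inChart x₁ y =
      (η.inChart x₀ ((extChartAt (𝓡 d) x₀ ∘ (extChartAt (𝓡 d) x₁).symm) y)).compContinuousLinearMap
        (fderiv ℝ (extChartAt (𝓡 d) x₀ ∘ (extChartAt (𝓡 d) x₁).symm) y) := by
  have h := η.pullback_inChart hy mdifferentiableAt_id hy'
  rwa [Form.pullback_id] at h

theorem contDiffAt_chart_change {x₀ x₁ : X} {y : EuclideanSpace ℝ (Fin d)}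
    (hy : y ∈ (extChartAt (𝓡 d) x₁).target)
    (hy' : (extChartAt (𝓡 d) x₁).symm y ∈ (chartAt (EuclideanSpace ℝ (Fin d)) x₀).source) :
    ContDiffAt ℝ ∞ (extChartAt (𝓡 d) x₀ ∘ (extChartAt (𝓡 d) x₁).symm) y :=
  contMDiffAt_iff_contDiffAt.1
    ((contMDiffAt_extChartAt' hy').comp y (contMDiffAt_extChartAt_symm hy))

theorem Form.eventually_inChart_change (η : Form d X k) {x₀ x₁ : X}
    {y : EuclideanSpace ℝ (Fin d)} (hy : y ∈ (extChartAt (𝓡 d) x₁).target)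
    (hy' : (extChartAt (𝓡 d) x₁).symm y ∈ (chartAt (EuclideanSpace ℝ (Fin d)) x₀).source) :
    η.inChart x₁ =ᶠ[𝓝 y] fun z =>
      (η.inChart x₀ ((extChartAt (𝓡 d) x₀ ∘ (extChartAt (𝓡 d) x₁).symm) z)).compContinuousLinearMap
        (fderiv ℝ (extChartAt (𝓡 d) x₀ ∘ (extChartAt (𝓡 d) x₁).symm) z) := by
  filter_upwards [eventually_extChartAt_symm hy
    ((chartAt (EuclideanSpace ℝ (Fin d)) x₀).open_source.mem_nhds hy')] with z hz
  exact η.inChart_change hz.1 hz.2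

theorem Form.contDiffAt_inChart_change {η : Form d X k} {x₀ x₁ x : X}
    (hx₀ : x ∈ (chartAt (EuclideanSpace ℝ (Fin d)) x₀).source)
    (hx₁ : x ∈ (chartAt (EuclideanSpace ℝ (Fin d)) x₁).source)
    (h : ContDiffAt ℝ ∞ (η.inChart x₀) (extChartAt (𝓡 d) x₀ x)) :
    ContDiffAt ℝ ∞ (η.inChart x₁) (extChartAt (𝓡 d) x₁ x) := by
  have hy := extChartAt_mem_target hx₁
  have hy' : (extChartAt (𝓡 d) x₁).symm (extChartAt (𝓡 d) x₁ x) ∈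
      (chartAt (EuclideanSpace ℝ (Fin d)) x₀).source := by rwa [extChartAt_symm_apply hx₁]
  have ht := contDiffAt_chart_change hy hy'
  refine ContDiffAt.congr_of_eventuallyEq ?_ (η.eventually_inChart_change hy hy')
  have h' : ContDiffAt ℝ ∞ (η.inChart x₀)
      ((extChartAt (𝓡 d) x₀ ∘ (extChartAt (𝓡 d) x₁).symm) (extChartAt (𝓡 d) x₁ x)) := by
    rwa [Function.comp_apply, extChartAt_symm_apply hx₁]
  exact contDiffAt_compContinuousLinearMap
    (f := η.inChart x₀ ∘ (extChartAt (𝓡 d) x₀ ∘ (extChartAt (𝓡 d) x₁).symm))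
    (h'.comp _ ht) (ht.fderiv_right (m := ∞) (by simp))

/-- Chart expressions are related by pullback along a smooth transition map, so the preferred chart
at the point may be replaced by any chart around it. -/
theorem Form.smoothAt_iff {η : Form d X k} {x₀ x : X}
    (hx : x ∈ (chartAt (EuclideanSpace ℝ (Fin d)) x₀).source) :
    η.SmoothAt x ↔ ContDiffAt ℝ ∞ (η.inChart x₀) (extChartAt (𝓡 d) x₀ x) :=
  ⟨Form.contDiffAt_inChart_change (mem_chart_source _ x) hx,
    Form.contDiffAt_inChart_change hx (mem_chart_source _ x)⟩

theorem Form.SmoothAt.contDiffAt_symm {η : Form d X k} {x₀ : X} {y : EuclideanSpace ℝ (Fin d)}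
    (hy : y ∈ (extChartAt (𝓡 d) x₀).target) (h : η.SmoothAt ((extChartAt (𝓡 d) x₀).symm y)) :
    ContDiffAt ℝ ∞ (η.inChart x₀) y := by
  have := (Form.smoothAt_iff (extChartAt_symm_mem_source hy)).1 h
  rwa [(extChartAt (𝓡 d) x₀).right_inv hy] at this

theorem Form.SmoothAt.congr {η η' : Form d X k} {x : X} (h : η.SmoothAt x)
    (he : ∀ᶠ z in 𝓝 x, η' z = η z) : η'.SmoothAt x :=
  ContDiffAt.congr_of_eventuallyEq h
    (Form.inChart_congr he (mem_chart_source (EuclideanSpace ℝ (Fin d)) x))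

theorem Form.smoothOn_iff {η : Form d X k} {U : Set X} (hU : IsOpen U) :
    η.SmoothOn U ↔ ∀ x ∈ U, η.SmoothAt x := by
  constructor
  · intro h x hx
    have hxs := mem_chart_source (EuclideanSpace ℝ (Fin d)) x
    refine (h x).contDiffAt ?_
    have hU' : U ∈ 𝓝 ((extChartAt (𝓡 d) x).symm (extChartAt (𝓡 d) x x)) := by
      rw [extChartAt_symm_apply hxs]; exact hU.mem_nhds hx
    exact eventually_extChartAt_symm (extChartAt_mem_target hxs) hU'
  · intro h x₀ y hy
    exact ((h _ hy.2).contDiffAt_symm hy.1).contDiffWithinAt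

theorem fderiv_chart_change {x₀ x₁ : X} {y : EuclideanSpace ℝ (Fin d)}
    (hy : y ∈ (extChartAt (𝓡 d) x₁).target)
    (hy' : (extChartAt (𝓡 d) x₁).symm y ∈ (chartAt (EuclideanSpace ℝ (Fin d)) x₀).source) :
    fderiv ℝ (extChartAt (𝓡 d) x₀ ∘ (extChartAt (𝓡 d) x₁).symm) y =
      (mfderiv (𝓡 d) 𝓘(ℝ, EuclideanSpace ℝ (Fin d)) (extChartAt (𝓡 d) x₀)
        ((extChartAt (𝓡 d) x₁).symm y)).comp
      (mfderiv 𝓘(ℝ, EuclideanSpace ℝ (Fin d)) (𝓡 d) (extChartAt (𝓡 d) x₁).symm y) := by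
  rw [← mfderiv_eq_fderiv]
  exact mfderiv_comp y (mdifferentiableAt_extChartAt' hy') (mdifferentiableAt_extChartAt_symm hy)

theorem two_le_infty : minSmoothness ℝ 2 ≤ (∞ : WithTop ℕ∞) := by
  rw [minSmoothness_of_isRCLikeNormedField]
  exact WithTop.coe_le_coe.2 le_top

/-- The exterior derivative can be computed in any chart. -/
theorem Form.SmoothAt.extd_inChart {η : Form d X k} {x₀ : X} {y : EuclideanSpace ℝ (Fin d)}
    (hy : y ∈ (extChartAt (𝓡 d) x₀).target) (h : η.SmoothAt ((extChartAt (𝓡 d) x₀).symm y)) :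
    η.extd.inChart x₀ y = extDeriv (η.inChart x₀) y := by
  have hs := mem_chart_source (EuclideanSpace ℝ (Fin d)) ((extChartAt (𝓡 d) x₀).symm y)
  -- `Form.extd` uses the preferred chart at the point itself; naturality of `extDeriv` under the
  -- transition map carries it over to the chart at `x₀`.
  rw [(η.eventually_inChart_change hy hs).extDeriv_eq,
    extDeriv_pullback (r := ∞)
      (f := extChartAt (𝓡 d) ((extChartAt (𝓡 d) x₀).symm y) ∘ (extChartAt (𝓡 d) x₀).symm)
      (ContDiffAt.differentiableAt h (by simp))
      (contDiffAt_chart_change hy hs) two_le_infty, fderiv_chart_change hy hs]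
  rfl

theorem Form.SmoothOn.extd {η : Form d X k} {U : Set X} (hU : IsOpen U) (h : η.SmoothOn U) :
    η.extd.SmoothOn U := by
  rw [Form.smoothOn_iff hU] at h ⊢
  intro x hx
  have hxs := mem_chart_source (EuclideanSpace ℝ (Fin d)) x
  have hU' : U ∈ 𝓝 ((extChartAt (𝓡 d) x).symm (extChartAt (𝓡 d) x x)) := by
    rw [extChartAt_symm_apply hxs]; exact hU.mem_nhds hx
  have he : η.extd.inChart x =ᶠ[𝓝 (extChartAt (𝓡 d) x x)] extDeriv (η.inChart x) := by
    filter_upwards [eventually_extChartAt_symm (extChartAt_mem_target hxs) hU'] with y hy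
    exact (h _ hy.2).extd_inChart hy.1
  refine ContDiffAt.congr_of_eventuallyEq ?_ he
  exact (ContinuousAlternatingMap.alternatizeUncurryFinCLM ℝ (EuclideanSpace ℝ (Fin d))
    ℝ).contDiff.contDiffAt.comp _ ((h x hx).fderiv_right (m := ∞) (by simp))

theorem Form.SmoothOn.extd_extd {η : Form d X k} {U : Set X} (hU : IsOpen U) (h : η.SmoothOn U)
    {x : X} (hx : x ∈ U) : η.extd.extd x = 0 := by
  rw [Form.smoothOn_iff hU] at h
  have hxs := mem_chart_source (EuclideanSpace ℝ (Fin d)) x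
  have hU' : U ∈ 𝓝 ((extChartAt (𝓡 d) x).symm (extChartAt (𝓡 d) x x)) := by
    rw [extChartAt_symm_apply hxs]; exact hU.mem_nhds hx
  have he : η.extd.inChart x =ᶠ[𝓝 (extChartAt (𝓡 d) x x)] extDeriv (η.inChart x) := by
    filter_upwards [eventually_extChartAt_symm (extChartAt_mem_target hxs) hU'] with y hy
    exact (h _ hy.2).extd_inChart hy.1
  rw [Form.extd, he.extDeriv_eq, extDeriv_extDeriv_apply (h x hx) two_le_infty]
  rfl

/-- A form with a given chart expression. -/
def Form.ofChart (x₀ : X) (β : EuclideanSpace ℝ (Fin d) → EuclideanSpace ℝ (Fin d) [⋀^Fin k]→L[ℝ] ℝ) :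
    Form d X k := fun x => (β (extChartAt (𝓡 d) x₀ x)).compContinuousLinearMap
  (mfderiv (𝓡 d) 𝓘(ℝ, EuclideanSpace ℝ (Fin d)) (extChartAt (𝓡 d) x₀) x)

theorem Form.ofChart_inChart {x₀ : X}
    (β : EuclideanSpace ℝ (Fin d) → EuclideanSpace ℝ (Fin d) [⋀^Fin k]→L[ℝ] ℝ)
    {y : EuclideanSpace ℝ (Fin d)} (hy : y ∈ (extChartAt (𝓡 d) x₀).target) :
    (Form.ofChart x₀ β).inChart x₀ y = β y := by
  have h := mfderiv_comp_mfderiv_extChartAt_symm hy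
  ext v
  have h3 : ∀ j, mfderiv (𝓡 d) 𝓘(ℝ, EuclideanSpace ℝ (Fin d)) (extChartAt (𝓡 d) x₀)
      ((extChartAt (𝓡 d) x₀).symm y)
      (mfderiv 𝓘(ℝ, EuclideanSpace ℝ (Fin d)) (𝓡 d) (extChartAt (𝓡 d) x₀).symm y (v j)) = v j :=
    fun j => congrArg (fun L => L (v j)) h
  have h4 := congrArg (β (extChartAt (𝓡 d) x₀ ((extChartAt (𝓡 d) x₀).symm y))) (funext h3)
  rw [(extChartAt (𝓡 d) x₀).right_inv hy] at h4
  rw [← h4, Form.inChart_def, Form.val, Form.ofChart, (extChartAt (𝓡 d) x₀).right_inv hy]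
  rfl

theorem Form.val_ext_of_inChart {η η' : Form d X k} {x₀ x : X}
    (hx : x ∈ (chartAt (EuclideanSpace ℝ (Fin d)) x₀).source)
    (h : η.inChart x₀ (extChartAt (𝓡 d) x₀ x) = η'.inChart x₀ (extChartAt (𝓡 d) x₀ x)) :
    η x = η' x := by
  have h1 := η.val_eq_inChart_comp hx
  rw [h, ← η'.val_eq_inChart_comp hx] at h1
  exact h1

/-- The Poincaré lemma: closed forms are locally exact. -/
theorem Form.exists_local_primitive {θ : Form d X (k + 1)} {U : Set X} (hU : IsOpen U)
    (hθ : θ.SmoothOn U) (hcl : ∀ x ∈ U, θ.extd x = 0) {p : X} (hp : p ∈ U) :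
    ∃ (V : Set X) (η : Form d X k), IsOpen V ∧ p ∈ V ∧ V ⊆ U ∧
      V ⊆ (chartAt (EuclideanSpace ℝ (Fin d)) p).source ∧
      η.SmoothOn V ∧ ∀ x ∈ V, η.extd x = θ x := by
  have hps := mem_chart_source (EuclideanSpace ℝ (Fin d)) p
  rw [Form.smoothOn_iff hU] at hθ
  have hU' : U ∈ 𝓝 ((extChartAt (𝓡 d) p).symm (extChartAt (𝓡 d) p p)) := by
    rw [extChartAt_symm_apply hps]; exact hU.mem_nhds hp
  obtain ⟨r, hr, hball⟩ := Metric.mem_nhds_iff.1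
    (eventually_extChartAt_symm (extChartAt_mem_target hps) hU')
  -- Solve in the chart at `p`, then transport the primitive back by `Form.ofChart`.
  obtain ⟨β, hβ, ρ, hρ, hρr, hd⟩ := exists_extDeriv_eq_of_contDiffOn (β := θ.inChart p) hr
    (fun y hy => ((hθ _ (hball hy).2).contDiffAt_symm (hball hy).1).contDiffWithinAt)
    (fun y hy => by
      rw [← (hθ _ (hball hy).2).extd_inChart (hball hy).1, Form.inChart_def, Form.val,
        hcl _ (hball hy).2]
      rfl)
  have hsm : ∀ x ∈ (chartAt (EuclideanSpace ℝ (Fin d)) p).source,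
      (Form.ofChart p β).inChart p =ᶠ[𝓝 (extChartAt (𝓡 d) p x)] β := fun x hx => by
    filter_upwards [extChartAt_target_mem_nhds_of_mem (extChartAt_mem_target hx)] with y hy
    exact Form.ofChart_inChart β hy
  have hsm' : ∀ x ∈ (chartAt (EuclideanSpace ℝ (Fin d)) p).source,
      (Form.ofChart p β).SmoothAt x := fun x hx =>
    (Form.smoothAt_iff hx).2 (hβ.contDiffAt.congr_of_eventuallyEq (hsm x hx))
  have hVo : IsOpen ((extChartAt (𝓡 d) p).source ∩
      extChartAt (𝓡 d) p ⁻¹' Metric.ball (extChartAt (𝓡 d) p p) ρ) :=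
    (continuousOn_extChartAt p).isOpen_inter_preimage (isOpen_extChartAt_source p)
      Metric.isOpen_ball
  have hVs : (extChartAt (𝓡 d) p).source ∩
      extChartAt (𝓡 d) p ⁻¹' Metric.ball (extChartAt (𝓡 d) p p) ρ ⊆
      (chartAt (EuclideanSpace ℝ (Fin d)) p).source := fun x hx => by simpa using hx.1
  refine ⟨_, Form.ofChart p β, hVo, ⟨by simp, Metric.mem_ball_self hρ⟩, ?_, hVs,
    (Form.smoothOn_iff hVo).2 fun x hx => hsm' x (hVs hx), ?_⟩
  · intro x hx
    have := (hball (Metric.ball_subset_ball hρr hx.2)).2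
    rwa [extChartAt_symm_apply (hVs hx)] at this
  · intro x hx
    refine Form.val_ext_of_inChart (hVs hx) ?_
    have hs := hsm' x (hVs hx)
    rw [← extChartAt_symm_apply (hVs hx)] at hs
    rw [hs.extd_inChart (extChartAt_mem_target (hVs hx)), (hsm x (hVs hx)).extDeriv_eq, hd _ hx.2]

theorem Form.ofFun_smoothAt_iff {u : X → ℝ} {x : X} :
    (Form.ofFun d u).SmoothAt x ↔ ContMDiffAt (𝓡 d) 𝓘(ℝ, ℝ) ∞ u x := by
  have hxs := mem_chart_source (EuclideanSpace ℝ (Fin d)) x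
  have hin : (Form.ofFun d u).inChart x = fun y =>
      ContinuousAlternatingMap.constOfIsEmpty ℝ (EuclideanSpace ℝ (Fin d)) (Fin 0)
        (u ((extChartAt (𝓡 d) x).symm y)) := rfl
  constructor
  · intro h
    have h1 : ContDiffAt ℝ ∞ (fun y => u ((extChartAt (𝓡 d) x).symm y)) (extChartAt (𝓡 d) x x) :=
      (ContinuousAlternatingMap.constOfIsEmptyLIE ℝ (EuclideanSpace ℝ (Fin d)) ℝ
        (Fin 0)).symm.contDiff.contDiffAt.comp _ h
    refine (h1.contMDiffAt.comp x (contMDiffAt_extChartAt' hxs)).congr_of_eventuallyEq ?_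
    filter_upwards [(chartAt (EuclideanSpace ℝ (Fin d)) x).open_source.mem_nhds hxs] with z hz
    simp only [Function.comp_apply, extChartAt_symm_apply hz]
  · intro h
    rw [← extChartAt_symm_apply hxs] at h
    have h1 := contMDiffAt_iff_contDiffAt.1
      (h.comp _ (contMDiffAt_extChartAt_symm (extChartAt_mem_target hxs)))
    exact (ContinuousAlternatingMap.constOfIsEmptyLIE ℝ (EuclideanSpace ℝ (Fin d)) ℝ
        (Fin 0)).contDiff.contDiffAt.comp _ h1

theorem Form.ofFun_smoothOn_iff {u : X → ℝ} {U : Set X} (hU : IsOpen U) :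
    (Form.ofFun d u).SmoothOn U ↔ ContMDiffOn (𝓡 d) 𝓘(ℝ, ℝ) ∞ u U := by
  rw [Form.smoothOn_iff hU]
  exact ⟨fun h x hx => (Form.ofFun_smoothAt_iff.1 (h x hx)).contMDiffWithinAt,
    fun h x hx => Form.ofFun_smoothAt_iff.2 (h.contMDiffAt (hU.mem_nhds hx))⟩

end FormCalculus

end GerbeTorus
end

noncomputable section
namespace GerbeTorus
set_option maxSynthPendingDepth 3

/-! ### Interchanging time and space derivatives -/

section MixedDerivative

open Topology

variable {E G : Type*} [NormedAddCommGroup E] [NormedSpace ℝ E] [NormedAddCommGroup G]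
  [NormedSpace ℝ G]

theorem deriv_eq_fderiv_apply {P : ℝ × E → G} {t : ℝ} {y : E}
    (hP : DifferentiableAt ℝ P (t, y)) :
    HasDerivAt (fun s => P (s, y)) (fderiv ℝ P (t, y) (1, 0)) t := by
  have h : HasDerivAt (fun s : ℝ => (s, y)) ((1 : ℝ), (0 : E)) t :=
    (hasDerivAt_id t).prodMk (hasDerivAt_const t y)
  exact hP.hasFDerivAt.comp_hasDerivAt t h

theorem fderiv_eq_fderiv_comp_inr {P : ℝ × E → G} {t : ℝ} {y : E}
    (hP : DifferentiableAt ℝ P (t, y)) :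
    fderiv ℝ (fun z => P (t, z)) y = (fderiv ℝ P (t, y)).comp (ContinuousLinearMap.inr ℝ ℝ E) :=
  (hP.hasFDerivAt.comp (f := fun z => (t, z)) y (hasFDerivAt_prodMk_right t y)).fderiv

/-- Symmetry of the second derivative of `P` at `(0, y)`, applied to one time and one space
direction. -/
theorem hasDerivAt_fderiv_of_contDiffAt {P : ℝ × E → G} {y : E}
    (hP : ContDiffAt ℝ ∞ P (0, y)) :
    HasDerivAt (fun t => fderiv ℝ (fun z => P (t, z)) y)
      (fderiv ℝ (fun z => deriv (fun t => P (t, z)) 0) y) 0 := by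
  have hd : ∀ᶠ q in 𝓝 ((0 : ℝ), y), DifferentiableAt ℝ P q :=
    ((hP.of_le (m := 1) (by simp)).eventually (by simp)).mono fun q hq =>
      hq.differentiableAt one_ne_zero
  have hd1 : ∀ᶠ t in 𝓝 (0 : ℝ), DifferentiableAt ℝ P (t, y) :=
    (Continuous.prodMk_left y).continuousAt.eventually hd
  have hd2 : ∀ᶠ z in 𝓝 y, DifferentiableAt ℝ P (0, z) :=
    (Continuous.prodMk_right (0 : ℝ)).continuousAt.eventually hd
  have hD : DifferentiableAt ℝ (fderiv ℝ P) (0, y) :=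
    (hP.fderiv_right (m := ∞) (by simp)).differentiableAt (by simp)
  have hsymm : IsSymmSndFDerivAt ℝ P (0, y) := hP.isSymmSndFDerivAt two_le_infty
  have h1 : HasDerivAt (fun t => fderiv ℝ (fun z => P (t, z)) y)
      ((fderiv ℝ (fderiv ℝ P) (0, y) (1, 0)).comp (ContinuousLinearMap.inr ℝ ℝ E)) 0 := by
    have h := (deriv_eq_fderiv_apply hD).clm_comp
      (hasDerivAt_const (0 : ℝ) (ContinuousLinearMap.inr ℝ ℝ E))
    simp only [ContinuousLinearMap.comp_zero, add_zero] at h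
    exact h.congr_of_eventuallyEq (hd1.mono fun t ht => fderiv_eq_fderiv_comp_inr ht)
  have h2 : fderiv ℝ (fun z => deriv (fun t => P (t, z)) 0) y =
      (fderiv ℝ (fderiv ℝ P) (0, y) (1, 0)).comp (ContinuousLinearMap.inr ℝ ℝ E) := by
    have he : (fun z => deriv (fun t => P (t, z)) 0) =ᶠ[𝓝 y] fun z => fderiv ℝ P (0, z) (1, 0) :=
      hd2.mono fun z hz => (deriv_eq_fderiv_apply hz).deriv
    have h3 : HasFDerivAt (fun z : E => fderiv ℝ P (0, z))
        ((fderiv ℝ (fderiv ℝ P) (0, y)).comp (ContinuousLinearMap.inr ℝ ℝ E)) y :=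
      hD.hasFDerivAt.comp (f := fun z => ((0 : ℝ), z)) y (hasFDerivAt_prodMk_right 0 y)
    rw [he.fderiv_eq, (h3.clm_apply (hasFDerivAt_const ((1 : ℝ), (0 : E)) y)).fderiv]
    ext v
    simpa using hsymm.eq (0, v) (1, 0)
  rwa [h2]

theorem hasDerivAt_compContinuousLinearMap {k : ℕ} {f : ℝ → E [⋀^Fin k]→L[ℝ] ℝ}
    {f' : E [⋀^Fin k]→L[ℝ] ℝ} {t : ℝ} (hf : HasDerivAt f f' t) (A : E →L[ℝ] E) :
    HasDerivAt (fun s => (f s).compContinuousLinearMap A) (f'.compContinuousLinearMap A) t := by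
  have h := (HasFDerivAt.continuousAlternatingMapCompContinuousLinearMap hf.hasFDerivAt
    (hasFDerivAt_const A t)).hasDerivAt
  simpa using h

end MixedDerivative

/-! ### The Lie derivative along the torus action -/

section LieDerivative

open Topology

theorem flow_zero {n : ℕ} {X : Type*} [AddAction (Torus n) X] (i : Fin n) (x : X) :
    flow i 0 x = x := by
  have : torusMk n (Pi.single i 0) = 0 := by
    ext j; simp [torusMk]
  rw [flow, this, zero_vadd]

variable {n d k : ℕ} {X : Type*} [TopologicalSpace X]
  [ChartedSpace (EuclideanSpace ℝ (Fin d)) X] [AddAction (Torus n) X]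

theorem SmoothTorusAction.contMDiff_flow (hact : SmoothTorusAction n d X) (i : Fin n) :
    ContMDiff (𝓘(ℝ, ℝ).prod (𝓡 d)) (𝓡 d) ∞ fun p : ℝ × X => flow i p.1 p.2 := by
  have h1 : ContMDiff 𝓘(ℝ, ℝ) 𝓘(ℝ, Fin n → ℝ) ∞ fun t : ℝ => (Pi.single i t : Fin n → ℝ) :=
    (ContinuousLinearMap.single ℝ (fun _ : Fin n => ℝ) i).contDiff.contMDiff
  exact ContMDiff.comp (g := fun p : (Fin n → ℝ) × X => torusMk n p.1 +ᵥ p.2)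
    (f := fun p : ℝ × X => ((Pi.single i p.1 : Fin n → ℝ), p.2)) hact
    ((h1.comp contMDiff_fst).prodMk contMDiff_snd)

theorem SmoothTorusAction.continuous_flow (hact : SmoothTorusAction n d X) (i : Fin n) :
    Continuous fun p : ℝ × X => flow i p.1 p.2 := (hact.contMDiff_flow i).continuous

theorem SmoothTorusAction.eventually_flow (hact : SmoothTorusAction n d X) (i : Fin n) {x : X}
    {p : X → Prop} (hp : ∀ᶠ z in 𝓝 x, p z) : ∀ᶠ t in 𝓝 (0 : ℝ), p (flow i t x) := by
  have h : ContinuousAt (fun t : ℝ => flow i t x) 0 :=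
    ((hact.continuous_flow i).comp (Continuous.prodMk_left x)).continuousAt
  have hp' : ∀ᶠ z in 𝓝 (flow i 0 x), p z := by rwa [flow_zero]
  exact h.eventually hp'

theorem SmoothTorusAction.contMDiff_flow_right (hact : SmoothTorusAction n d X) (i : Fin n)
    (t : ℝ) : ContMDiff (𝓡 d) (𝓡 d) ∞ (flow i t : X → X) := by
  have h : ContMDiff (𝓡 d) (𝓘(ℝ, ℝ).prod (𝓡 d)) ∞ fun x : X => (t, x) :=
    contMDiff_const.prodMk contMDiff_id
  exact (hact.contMDiff_flow i).comp h

/-- For small times the flow keeps `x` inside any given neighbourhood. This locality allows `ℒ` to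
be applied to identities that hold only on patches, which the action need not preserve. -/
theorem SmoothTorusAction.lie_congr (hact : SmoothTorusAction n d X) (i : Fin n)
    {η η' : Form d X k} {x : X} (h : ∀ᶠ z in 𝓝 x, η z = η' z) : η.lie i x = η'.lie i x := by
  refine Filter.EventuallyEq.deriv_eq (F := EuclideanSpace ℝ (Fin d) [⋀^Fin k]→L[ℝ] ℝ) ?_
  filter_upwards [hact.eventually_flow i h] with t ht
  rw [Form.pullback, Form.pullback, ht]

theorem Form.Invariant.lie_eq_zero {η : Form d X k} (h : η.Invariant n) (i : Fin n) (x : X) :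
    η.lie i x = 0 := by
  have : ∀ t : ℝ, η.pullback (flow i t) = η := fun t => h _
  simp only [Form.lie, this]
  exact deriv_const (F := EuclideanSpace ℝ (Fin d) [⋀^Fin k]→L[ℝ] ℝ) (0 : ℝ) (η x)

theorem SmoothTorusAction.lie_ofFun (hact : SmoothTorusAction n d X) (i : Fin n) {u : X → ℝ}
    {x : X} (hu : ContMDiffAt (𝓡 d) 𝓘(ℝ, ℝ) ∞ u x) :
    HasDerivAt (fun t => u (flow i t x)) (deriv (fun t => u (flow i t x)) 0) 0 ∧
    (Form.ofFun d u).lie i x = Form.ofFun d (fun x => deriv (fun t => u (flow i t x)) 0) x := by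
  have h1 : ContMDiffAt 𝓘(ℝ, ℝ) 𝓘(ℝ, ℝ) ∞ (fun t : ℝ => u (flow i t x)) 0 := by
    have h : ContMDiff 𝓘(ℝ, ℝ) (𝓘(ℝ, ℝ).prod (𝓡 d)) ∞ fun t : ℝ => (t, x) :=
      contMDiff_id.prodMk contMDiff_const
    have h2 : ContMDiff 𝓘(ℝ, ℝ) (𝓡 d) ∞ (fun t : ℝ => flow i t x) :=
      (hact.contMDiff_flow i).comp h
    rw [← flow_zero i x] at hu
    exact ContMDiffAt.comp (f := fun t : ℝ => flow i t x) 0 (by simpa [flow_zero] using hu)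
      h2.contMDiffAt
  have h3 := ((contMDiffAt_iff_contDiffAt.1 h1).differentiableAt (by simp)).hasDerivAt
  refine ⟨h3, ?_⟩
  have h4 := (ContinuousAlternatingMap.constOfIsEmptyLIE ℝ (EuclideanSpace ℝ (Fin d)) ℝ
    (Fin 0)).toContinuousLinearEquiv.toContinuousLinearMap.hasFDerivAt.comp_hasDerivAt 0 h3
  refine Eq.trans ?_ h4.deriv
  refine Filter.EventuallyEq.deriv_eq (F := EuclideanSpace ℝ (Fin d) [⋀^Fin 0]→L[ℝ] ℝ)
    (Filter.Eventually.of_forall fun t => ?_)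
  ext v
  rfl

/-- The flow in a chart. -/
def flowInChart (i : Fin n) (x₀ : X) (q : ℝ × EuclideanSpace ℝ (Fin d)) :
    EuclideanSpace ℝ (Fin d) :=
  extChartAt (𝓡 d) x₀ (flow i q.1 ((extChartAt (𝓡 d) x₀).symm q.2))

/-- The pullback of a form under the flow, in a chart. -/
def Form.flowPullback (η : Form d X k) (i : Fin n) (x₀ : X)
    (q : ℝ × EuclideanSpace ℝ (Fin d)) : EuclideanSpace ℝ (Fin d) [⋀^Fin k]→L[ℝ] ℝ :=
  (η.inChart x₀ (flowInChart i x₀ q)).compContinuousLinearMap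
    (fderiv ℝ (fun z => flowInChart i x₀ (q.1, z)) q.2)

variable [IsManifold (𝓡 d) ∞ X]

theorem SmoothTorusAction.eventually_flow_chart (hact : SmoothTorusAction n d X) (i : Fin n)
    {x₀ : X} {t : ℝ} {y : EuclideanSpace ℝ (Fin d)} (hy : y ∈ (extChartAt (𝓡 d) x₀).target)
    {p : X → Prop} (hp : ∀ᶠ z in 𝓝 (flow i t ((extChartAt (𝓡 d) x₀).symm y)), p z) :
    ∀ᶠ q in 𝓝 (t, y), q.2 ∈ (extChartAt (𝓡 d) x₀).target ∧
      p (flow i q.1 ((extChartAt (𝓡 d) x₀).symm q.2)) := by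
  refine Filter.Eventually.and (continuous_snd.continuousAt.preimage_mem_nhds
    (extChartAt_target_mem_nhds_of_mem hy)) ?_
  have h1 : ContinuousAt (fun q : ℝ × EuclideanSpace ℝ (Fin d) =>
      (q.1, (extChartAt (𝓡 d) x₀).symm q.2)) (t, y) :=
    continuous_fst.continuousAt.prodMk
      (ContinuousAt.comp (f := Prod.snd) (x := (t, y)) (continuousAt_extChartAt_symm_of_mem hy)
        continuous_snd.continuousAt)
  have h2 := ContinuousAt.comp (x := (t, y)) ((hact.continuous_flow i).continuousAt) h1
  exact h2.eventually hp

theorem SmoothTorusAction.contDiffAt_flowInChart (hact : SmoothTorusAction n d X) (i : Fin n)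
    {x₀ : X} {t : ℝ} {y : EuclideanSpace ℝ (Fin d)} (hy : y ∈ (extChartAt (𝓡 d) x₀).target)
    (hs : flow i t ((extChartAt (𝓡 d) x₀).symm y) ∈
      (chartAt (EuclideanSpace ℝ (Fin d)) x₀).source) :
    ContDiffAt ℝ ∞ (flowInChart i x₀) (t, y) := by
  refine contMDiffAt_iff_contDiffAt.1 ?_
  have h1 : ContMDiffAt 𝓘(ℝ, ℝ × EuclideanSpace ℝ (Fin d)) (𝓘(ℝ, ℝ).prod (𝓡 d)) ∞
      (fun q : ℝ × EuclideanSpace ℝ (Fin d) => (q.1, (extChartAt (𝓡 d) x₀).symm q.2)) (t, y) :=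
    contDiff_fst.contMDiff.contMDiffAt.prodMk
      (ContMDiffAt.comp (t, y) (f := Prod.snd) (contMDiffAt_extChartAt_symm hy)
        contDiff_snd.contMDiff.contMDiffAt)
  have h2 := ContMDiffAt.comp (t, y) ((hact.contMDiff_flow i).contMDiffAt) h1
  exact ContMDiffAt.comp (t, y) (contMDiffAt_extChartAt' hs) h2

theorem SmoothTorusAction.flowPullback_eq (hact : SmoothTorusAction n d X) (i : Fin n)
    (η : Form d X k) {x₀ : X} {t : ℝ} {y : EuclideanSpace ℝ (Fin d)}
    (hy : y ∈ (extChartAt (𝓡 d) x₀).target)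
    (hs : flow i t ((extChartAt (𝓡 d) x₀).symm y) ∈
      (chartAt (EuclideanSpace ℝ (Fin d)) x₀).source) :
    (η.pullback (flow i t)).inChart x₀ y = η.flowPullback i x₀ (t, y) :=
  η.pullback_inChart hy ((hact.contMDiff_flow_right i t).mdifferentiableAt (by simp)) hs

theorem SmoothTorusAction.contDiffAt_flowPullback (hact : SmoothTorusAction n d X) (i : Fin n)
    {η : Form d X k} {x₀ : X} {t : ℝ} {y : EuclideanSpace ℝ (Fin d)}
    (hy : y ∈ (extChartAt (𝓡 d) x₀).target)
    (hs : flow i t ((extChartAt (𝓡 d) x₀).symm y) ∈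
      (chartAt (EuclideanSpace ℝ (Fin d)) x₀).source)
    (hη : η.SmoothAt (flow i t ((extChartAt (𝓡 d) x₀).symm y))) :
    ContDiffAt ℝ ∞ (η.flowPullback i x₀) (t, y) := by
  have hΨ := hact.contDiffAt_flowInChart i hy hs
  refine contDiffAt_compContinuousLinearMap (f := η.inChart x₀ ∘ flowInChart i x₀)
    (ContDiffAt.comp _ ((Form.smoothAt_iff hs).1 hη) hΨ) ?_
  have he : (fun q : ℝ × EuclideanSpace ℝ (Fin d) =>
      fderiv ℝ (fun z => flowInChart i x₀ (q.1, z)) q.2) =ᶠ[𝓝 (t, y)] fun q =>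
      (fderiv ℝ (flowInChart i x₀) q).comp
        (ContinuousLinearMap.inr ℝ ℝ (EuclideanSpace ℝ (Fin d))) := by
    filter_upwards [hact.eventually_flow_chart i hy
      ((chartAt (EuclideanSpace ℝ (Fin d)) x₀).open_source.mem_nhds hs)] with q hq
    exact fderiv_eq_fderiv_comp_inr
      ((hact.contDiffAt_flowInChart i hq.1 hq.2).differentiableAt (by simp))
  exact ((hΨ.fderiv_right (m := ∞) (by simp)).clm_comp contDiffAt_const).congr_of_eventuallyEq he

theorem SmoothTorusAction.contDiffAt_flowPullback_zero (hact : SmoothTorusAction n d X)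
    (i : Fin n) {η : Form d X k} {x₀ : X} {y : EuclideanSpace ℝ (Fin d)}
    (hy : y ∈ (extChartAt (𝓡 d) x₀).target)
    (hη : η.SmoothAt ((extChartAt (𝓡 d) x₀).symm y)) :
    ContDiffAt ℝ ∞ (η.flowPullback i x₀) (0, y) :=
  hact.contDiffAt_flowPullback i hy
    (by rw [flow_zero]; exact extChartAt_symm_mem_source hy) (by rwa [flow_zero])

/-- For smooth forms the `deriv` in `Form.lie` is a true derivative and not the default value `0`.
At a fixed point the chart differential is a fixed linear map, so the derivative passes between the
tangent space and the chart, where the pulled-back form is jointly smooth in time and position. -/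
theorem SmoothTorusAction.hasDerivAt_pullback_inChart (hact : SmoothTorusAction n d X) (i : Fin n)
    {η : Form d X k} {x₀ : X} {y : EuclideanSpace ℝ (Fin d)}
    (hy : y ∈ (extChartAt (𝓡 d) x₀).target)
    (hη : η.SmoothAt ((extChartAt (𝓡 d) x₀).symm y)) :
    HasDerivAt (fun t => (η.pullback (flow i t)).val ((extChartAt (𝓡 d) x₀).symm y))
        ((η.lie i).val ((extChartAt (𝓡 d) x₀).symm y)) 0 ∧
      (η.lie i).inChart x₀ y = deriv (fun t => η.flowPullback i x₀ (t, y)) 0 := by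
  have hsrc := extChartAt_symm_mem_source hy
  have hP := deriv_eq_fderiv_apply
    ((hact.contDiffAt_flowPullback_zero i hy hη).differentiableAt (by simp))
  have hev : ∀ᶠ t in 𝓝 (0 : ℝ), (η.pullback (flow i t)).inChart x₀ y =
      η.flowPullback i x₀ (t, y) :=
    (hact.eventually_flow i ((chartAt (EuclideanSpace ℝ (Fin d)) x₀).open_source.mem_nhds
      hsrc)).mono fun t ht => hact.flowPullback_eq i η hy ht
  have hin : HasDerivAt (fun t => (η.pullback (flow i t)).inChart x₀ y)
      (fderiv ℝ (η.flowPullback i x₀) (0, y) (1, 0)) 0 := hP.congr_of_eventuallyEq hev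
  have hval : HasDerivAt (fun t => (η.pullback (flow i t)).val ((extChartAt (𝓡 d) x₀).symm y))
      ((η.lie i).val ((extChartAt (𝓡 d) x₀).symm y)) 0 := by
    have h1 : DifferentiableAt ℝ
        (fun t => (η.pullback (flow i t)).val ((extChartAt (𝓡 d) x₀).symm y)) 0 := by
      have h2 := hasDerivAt_compContinuousLinearMap hin
        (mfderiv (𝓡 d) 𝓘(ℝ, EuclideanSpace ℝ (Fin d)) (extChartAt (𝓡 d) x₀)
          ((extChartAt (𝓡 d) x₀).symm y))
      refine h2.differentiableAt.congr_of_eventuallyEq (Filter.Eventually.of_forall fun t => ?_)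
      have h3 := (η.pullback (flow i t)).val_eq_inChart_comp hsrc
      rw [(extChartAt (𝓡 d) x₀).right_inv hy] at h3
      exact h3
    exact h1.hasDerivAt
  refine ⟨hval, ?_⟩
  have h4 := hasDerivAt_compContinuousLinearMap hval
    (mfderiv 𝓘(ℝ, EuclideanSpace ℝ (Fin d)) (𝓡 d) (extChartAt (𝓡 d) x₀).symm y)
  rw [hP.deriv]
  exact h4.unique hin

theorem SmoothTorusAction.hasDerivAt_pullback (hact : SmoothTorusAction n d X) (i : Fin n)
    {η : Form d X k} {x : X} (hη : η.SmoothAt x) :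
    HasDerivAt (fun t => (η.pullback (flow i t)).val x) ((η.lie i).val x) 0 := by
  have hs := mem_chart_source (EuclideanSpace ℝ (Fin d)) x
  have he := extChartAt_symm_apply hs
  have h := (hact.hasDerivAt_pullback_inChart i (η := η) (extChartAt_mem_target hs)
    (by rwa [he])).1
  rwa [he] at h

theorem SmoothTorusAction.lie_add (hact : SmoothTorusAction n d X) (i : Fin n)
    {η η' : Form d X k} {x : X} (hη : η.SmoothAt x) (hη' : η'.SmoothAt x) :
    (η + η').lie i x = η.lie i x + η'.lie i x :=
  ((hact.hasDerivAt_pullback i hη).add (hact.hasDerivAt_pullback i hη')).deriv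

theorem SmoothTorusAction.lie_sub (hact : SmoothTorusAction n d X) (i : Fin n)
    {η η' : Form d X k} {x : X} (hη : η.SmoothAt x) (hη' : η'.SmoothAt x) :
    (η - η').lie i x = η.lie i x - η'.lie i x :=
  ((hact.hasDerivAt_pullback i hη).sub (hact.hasDerivAt_pullback i hη')).deriv

theorem SmoothTorusAction.eventually_lie_inChart (hact : SmoothTorusAction n d X) (i : Fin n)
    {η : Form d X k} {U : Set X} (hU : IsOpen U) (hη : η.SmoothOn U) {x : X} (hx : x ∈ U) :
    (η.lie i).inChart x =ᶠ[𝓝 (extChartAt (𝓡 d) x x)] fun y =>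
      deriv (fun t => η.flowPullback i x (t, y)) 0 := by
  rw [Form.smoothOn_iff hU] at hη
  have hxs := mem_chart_source (EuclideanSpace ℝ (Fin d)) x
  have hU' : U ∈ 𝓝 ((extChartAt (𝓡 d) x).symm (extChartAt (𝓡 d) x x)) := by
    rw [extChartAt_symm_apply hxs]; exact hU.mem_nhds hx
  filter_upwards [eventually_extChartAt_symm (extChartAt_mem_target hxs) hU'] with y hy
  exact (hact.hasDerivAt_pullback_inChart i hy.1 (hη _ hy.2)).2

theorem SmoothTorusAction.smoothOn_lie (hact : SmoothTorusAction n d X) (i : Fin n)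
    {η : Form d X k} {U : Set X} (hU : IsOpen U) (hη : η.SmoothOn U) :
    (η.lie i).SmoothOn U := by
  rw [Form.smoothOn_iff hU]
  intro x hx
  have hxs := mem_chart_source (EuclideanSpace ℝ (Fin d)) x
  have hη' := (Form.smoothOn_iff hU).1 hη x hx
  rw [← extChartAt_symm_apply hxs] at hη'
  have hP := hact.contDiffAt_flowPullback_zero i (extChartAt_mem_target hxs) hη'
  have hd : ∀ᶠ q in 𝓝 ((0 : ℝ), extChartAt (𝓡 d) x x),
      DifferentiableAt ℝ (η.flowPullback i x) q :=
    ((hP.of_le (m := 1) (by simp)).eventually (by simp)).mono fun q hq =>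
      hq.differentiableAt one_ne_zero
  have hd2 : ∀ᶠ z in 𝓝 (extChartAt (𝓡 d) x x), DifferentiableAt ℝ (η.flowPullback i x) (0, z) :=
    (Continuous.prodMk_right (0 : ℝ)).continuousAt.eventually hd
  have h1 : ContDiffAt ℝ ∞ (fun z => fderiv ℝ (η.flowPullback i x) (0, z) (1, 0))
      (extChartAt (𝓡 d) x x) :=
    (ContDiffAt.comp (f := fun z => ((0 : ℝ), z)) (extChartAt (𝓡 d) x x)
      (hP.fderiv_right (m := ∞) (by simp)) (contDiffAt_const.prodMk contDiffAt_id)).clm_apply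
      contDiffAt_const
  refine (h1.congr_of_eventuallyEq ?_).congr_of_eventuallyEq
    (hact.eventually_lie_inChart i hU hη hx)
  exact hd2.mono fun z hz => (deriv_eq_fderiv_apply hz).deriv

/-- The Lie derivative commutes with the exterior derivative. -/
theorem SmoothTorusAction.extd_lie (hact : SmoothTorusAction n d X) (i : Fin n)
    {η : Form d X k} {U : Set X} (hU : IsOpen U) (hη : η.SmoothOn U) {x : X} (hx : x ∈ U) :
    (η.lie i).extd x = η.extd.lie i x := by
  have hxs := mem_chart_source (EuclideanSpace ℝ (Fin d)) x
  have hyt := extChartAt_mem_target hxs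
  have hsm := (Form.smoothOn_iff hU).1 hη
  have hsd := (Form.smoothOn_iff hU).1 (hη.extd hU)
  have hsl := (Form.smoothOn_iff hU).1 (hact.smoothOn_lie i hU hη)
  have he := extChartAt_symm_apply hxs
  have hU' : U ∈ 𝓝 (flow i 0 ((extChartAt (𝓡 d) x).symm (extChartAt (𝓡 d) x x))) := by
    rw [flow_zero, he]; exact hU.mem_nhds hx
  have hS' : (chartAt (EuclideanSpace ℝ (Fin d)) x).source ∈
      𝓝 (flow i 0 ((extChartAt (𝓡 d) x).symm (extChartAt (𝓡 d) x x))) := by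
    rw [flow_zero, he]; exact (chartAt (EuclideanSpace ℝ (Fin d)) x).open_source.mem_nhds hxs
  refine Form.val_ext_of_inChart hxs ?_
  rw [Form.SmoothAt.extd_inChart hyt (by rw [he]; exact hsl x hx),
    (hact.eventually_lie_inChart i hU hη hx).extDeriv_eq,
    (hact.hasDerivAt_pullback_inChart i hyt (by rw [he]; exact hsd x hx)).2]
  have hP := hact.contDiffAt_flowPullback_zero i (η := η) hyt (by rw [he]; exact hsm x hx)
  have h1 := (ContinuousAlternatingMap.alternatizeUncurryFinCLM ℝ (EuclideanSpace ℝ (Fin d))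
    ℝ).hasFDerivAt.comp_hasDerivAt 0 (hasDerivAt_fderiv_of_contDiffAt hP)
  -- `d` has now been moved inside the time derivative. It remains to compare the functions of `t`:
  -- for small `t`, `d` commutes with pullback under the flow.
  refine Eq.trans h1.deriv.symm (Filter.EventuallyEq.deriv_eq ?_)
  have hev := (Continuous.prodMk_left (extChartAt (𝓡 d) x x)).continuousAt.eventually
    (hact.eventually_flow_chart i hyt (Filter.inter_mem hU' hS'))
  filter_upwards [hev] with t ht
  have hft := hact.contDiffAt_flowInChart i ht.1 ht.2.2
  have hmem := extChartAt_mem_target ht.2.2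
  have hinv := extChartAt_symm_apply ht.2.2
  have hd := Form.SmoothAt.extd_inChart (η := η) hmem (by rw [hinv]; exact hsm _ ht.2.1)
  have hdiff : DifferentiableAt ℝ (η.inChart x) (flowInChart i x (t, extChartAt (𝓡 d) x x)) :=
    ContDiffAt.differentiableAt ((Form.smoothAt_iff ht.2.2).1 (hsm _ ht.2.1)) (by simp)
  have hpb := extDeriv_pullback (x := extChartAt (𝓡 d) x x) (r := ∞)
    (f := fun z => flowInChart i x (t, z)) hdiff
    (hft.comp (extChartAt (𝓡 d) x x) (contDiffAt_const.prodMk contDiffAt_id)) two_le_infty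
  refine Eq.trans hpb ?_
  rw [Form.flowPullback]
  congr 1
  exact hd.symm

end LieDerivative

end GerbeTorus
end

noncomputable section
namespace GerbeTorus
set_option maxSynthPendingDepth 3

/-! ### Partitions of unity on an open subset -/

section Partition

open Topology

variable {d : ℕ} {X : Type*} [TopologicalSpace X] [T2Space X] [SecondCountableTopology X]
  [ChartedSpace (EuclideanSpace ℝ (Fin d)) X] [IsManifold (𝓡 d) ∞ X]

/-- A partition of unity of the open submanifold `U`, extended by zero. Near `p` only the finitely
many functions with `p` in their closed support contribute, and subordination puts `p` in the
corresponding sets `S q`. -/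
theorem exists_smooth_partition {U : Set X} (hU : IsOpen U) {S : X → Set X}
    (hS : ∀ p, IsOpen (S p)) (hpS : ∀ p ∈ U, p ∈ S p) :
    ∃ ρ : X → X → ℝ, (∀ q, ContMDiffOn (𝓡 d) 𝓘(ℝ, ℝ) ∞ (ρ q) U) ∧
      ∀ p ∈ U, ∃ F : Finset X, (∀ q ∈ F, q ∈ U ∧ p ∈ S q) ∧
        ∀ᶠ x in 𝓝 p, (∀ q ∉ F, ρ q x = 0) ∧ ∑ q ∈ F, ρ q x = 1 := by
  classical
  let V : TopologicalSpace.Opens X := ⟨U, hU⟩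
  have : LocallyCompactSpace X := ChartedSpace.locallyCompactSpace (EuclideanSpace ℝ (Fin d)) X
  have : LocallyCompactSpace V := hU.isOpenEmbedding_subtypeVal.locallyCompactSpace
  obtain ⟨f, hf⟩ := SmoothPartitionOfUnity.exists_isSubordinate (𝓡 d) (isClosed_univ (X := V))
    (fun q : V => (Subtype.val ⁻¹' S q : Set V)) (fun q => (hS q).preimage continuous_subtype_val)
    (fun q _ => Set.mem_iUnion.2 ⟨q, hpS q q.2⟩)
  let ρ : X → X → ℝ := fun q x => if h : q ∈ U ∧ x ∈ U then f ⟨q, h.1⟩ ⟨x, h.2⟩ else 0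
  have hρ : ∀ (q : V) (x : V), ρ q x = f q x := fun q x => by
    simp only [ρ]
    rw [dif_pos ⟨q.2, x.2⟩]
  refine ⟨ρ, fun q x hx => ?_, fun p hp => ?_⟩
  · refine ContMDiffAt.contMDiffWithinAt ?_
    by_cases hq : q ∈ U
    · have h := (f ⟨q, hq⟩).contMDiff.contMDiffAt (x := (⟨x, hx⟩ : V))
      refine (contMDiffAt_subtype_iff (U := V) (f := ρ q) (x := ⟨x, hx⟩)).1
        (h.congr_of_eventuallyEq (Filter.Eventually.of_forall fun y => hρ ⟨q, hq⟩ y))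
    · have : ρ q = fun _ => 0 := by
        funext y
        simp [ρ, hq]
      rw [this]
      exact contMDiffAt_const
  · refine ⟨(f.fintsupport ⟨p, hp⟩).image Subtype.val, fun q hq => ?_, ?_⟩
    · obtain ⟨q, hq', rfl⟩ := Finset.mem_image.1 hq
      exact ⟨q.2, hf q ((f.mem_fintsupport_iff ⟨p, hp⟩ q).1 hq')⟩
    · have hmap : 𝓝 p = Filter.map (Subtype.val : V → X) (𝓝 ⟨p, hp⟩) :=
        (hU.isOpenEmbedding_subtypeVal.map_nhds_eq ⟨p, hp⟩).symm
      rw [hmap, Filter.eventually_map]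
      filter_upwards [f.eventually_finsupport_subset ⟨p, hp⟩] with x hx
      refine ⟨fun q hq => ?_, ?_⟩
      · by_cases hqU : q ∈ U
        · rw [hρ ⟨q, hqU⟩ x]
          by_contra hne
          exact hq (Finset.mem_image.2 ⟨⟨q, hqU⟩, hx ((f.mem_finsupport x).2 hne), rfl⟩)
        · simp [ρ, hqU]
      · rw [Finset.sum_image fun _ _ _ _ h => Subtype.ext h]
        simp only [hρ]
        exact f.sum_finsupport' x (Set.mem_univ x) hx

/-- Picks for each `x` an index whose partition function is nonzero at `x`. A choice depending on
`x` alone thus takes, near any `p`, only finitely many values, all usable at `p`; estimates for each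
index can then be intersected. -/
theorem exists_index_function {U : Set X} (hU : IsOpen U) {S : X → Set X}
    (hS : ∀ p, IsOpen (S p)) (hpS : ∀ p ∈ U, p ∈ S p) (d : ℕ)
    [ChartedSpace (EuclideanSpace ℝ (Fin d)) X] [IsManifold (𝓡 d) ∞ X] :
    ∃ ind : X → X, ∀ p ∈ U, ∃ F : Finset X, (∀ q ∈ F, q ∈ U ∧ p ∈ S q) ∧
      ∀ᶠ x in 𝓝 p, ind x ∈ F := by
  classical
  obtain ⟨ρ, -, hρ⟩ := exists_smooth_partition (d := d) hU hS hpS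
  refine ⟨fun x => if h : ∃ q, ρ q x ≠ 0 then h.choose else x, fun p hp => ?_⟩
  obtain ⟨F, hF, hev⟩ := hρ p hp
  refine ⟨F, hF, hev.mono fun x hx => ?_⟩
  have hex : ∃ q, ρ q x ≠ 0 := by
    by_contra! hne
    simpa [hne] using hx.2
  beta_reduce
  rw [dif_pos hex]
  by_contra hn
  exact hex.choose_spec (hx.1 _ hn)

end Partition

end GerbeTorus
end

noncomputable section
namespace GerbeTorus
set_option maxSynthPendingDepth 3

/-! ### From forms to cochains by integration along segments -/

section Cochain

open Topology

variable {d : ℕ} {X : Type*} [TopologicalSpace X] [ChartedSpace (EuclideanSpace ℝ (Fin d)) X]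

/-- The integral of a `1`-form along the segment from `x` to `y` in the chart at `q`. -/
def Form.segmentIntegral (η : Form d X 1) (q x y : X) : ℝ :=
  ∫ t in (0 : ℝ)..1, η.inChart q
    (AffineMap.lineMap (extChartAt (𝓡 d) q x) (extChartAt (𝓡 d) q y) t)
    (fun _ => extChartAt (𝓡 d) q y - extChartAt (𝓡 d) q x)

theorem Form.segmentIntegral_zero (q x y : X) :
    (0 : Form d X 1).segmentIntegral q x y = 0 := by
  have : (0 : Form d X 1).inChart q = 0 := rfl
  simp [Form.segmentIntegral, this]

variable [IsManifold (𝓡 d) ∞ X]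

theorem Form.extd_ofFun_inChart {u : X → ℝ} {x₀ : X} {y : EuclideanSpace ℝ (Fin d)}
    (hy : y ∈ (extChartAt (𝓡 d) x₀).target)
    (h : (Form.ofFun d u).SmoothAt ((extChartAt (𝓡 d) x₀).symm y))
    (v : Fin 1 → EuclideanSpace ℝ (Fin d)) :
    DifferentiableAt ℝ (u ∘ (extChartAt (𝓡 d) x₀).symm) y ∧
    (Form.ofFun d u).extd.inChart x₀ y v =
      fderiv ℝ (u ∘ (extChartAt (𝓡 d) x₀).symm) y (v 0) := by
  refine ⟨?_, ?_⟩
  · have h1 := contMDiffAt_iff_contDiffAt.1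
      ((Form.ofFun_smoothAt_iff.1 h).comp _ (contMDiffAt_extChartAt_symm hy))
    exact h1.differentiableAt (by simp)
  · have hin : (Form.ofFun d u).inChart x₀ = fun y =>
        ContinuousAlternatingMap.constOfIsEmpty ℝ (EuclideanSpace ℝ (Fin d)) (Fin 0)
          ((u ∘ (extChartAt (𝓡 d) x₀).symm) y) := rfl
    rw [h.extd_inChart hy, hin, extDeriv_constOfIsEmpty]
    rfl

/-- The fundamental theorem of calculus on a chart segment. A ball in the chart is convex, so the
segment stays where `dg = η - η'`. -/
theorem Form.exists_segmentIntegral_sub {η η' : Form d X 1} {g : X → ℝ} {V : Set X} {p q : X}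
    (hV : IsOpen V) (hp : p ∈ V) (hq : p ∈ (chartAt (EuclideanSpace ℝ (Fin d)) q).source)
    (hη : η.SmoothOn V) (hη' : η'.SmoothOn V) (hg : (Form.ofFun d g).SmoothOn V)
    (hd : ∀ x ∈ V, (Form.ofFun d g).extd x = η x - η' x) :
    ∃ M ∈ 𝓝 p, ∀ x ∈ M, ∀ y ∈ M,
      η.segmentIntegral q x y - η'.segmentIntegral q x y = g y - g x := by
  rw [Form.smoothOn_iff hV] at hη hη' hg
  have hV' : V ∈ 𝓝 ((extChartAt (𝓡 d) q).symm (extChartAt (𝓡 d) q p)) := by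
    rw [extChartAt_symm_apply hq]; exact hV.mem_nhds hp
  obtain ⟨r, hr, hball⟩ := Metric.mem_nhds_iff.1
    (eventually_extChartAt_symm (extChartAt_mem_target hq) hV')
  refine ⟨(chartAt (EuclideanSpace ℝ (Fin d)) q).source ∩
    extChartAt (𝓡 d) q ⁻¹' Metric.ball (extChartAt (𝓡 d) q p) r, ?_, ?_⟩
  · exact Filter.inter_mem ((chartAt (EuclideanSpace ℝ (Fin d)) q).open_source.mem_nhds hq)
      ((contMDiffAt_extChartAt' (n := ∞) hq).continuousAt.preimage_mem_nhds
        (Metric.ball_mem_nhds _ hr))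
  rintro x ⟨hxs, hx⟩ y ⟨hys, hy⟩
  set a := extChartAt (𝓡 d) q x with ha
  set b := extChartAt (𝓡 d) q y with hb
  have hmem : ∀ t ∈ Set.uIcc (0 : ℝ) 1, AffineMap.lineMap a b t ∈
      Metric.ball (extChartAt (𝓡 d) q p) r := fun t ht => by
    rw [Set.uIcc_of_le zero_le_one] at ht
    exact (convex_ball _ _).lineMap_mem hx hy ht
  have hline : Continuous fun t : ℝ => AffineMap.lineMap a b t := AffineMap.lineMap_continuous
  have hint : ∀ ζ : Form d X 1, (∀ x ∈ V, ζ.SmoothAt x) → IntervalIntegrable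
      (fun t : ℝ => ζ.inChart q (AffineMap.lineMap a b t) (fun _ => b - a))
      MeasureTheory.volume 0 1 := fun ζ hζ => by
    refine ContinuousOn.intervalIntegrable fun t ht => ContinuousAt.continuousWithinAt ?_
    have hb' := hball (hmem t ht)
    have h1 : ContinuousAt (fun t : ℝ => ζ.inChart q (AffineMap.lineMap a b t)) t :=
      ContinuousAt.comp (g := ζ.inChart q)
        (((hζ _ hb'.2).contDiffAt_symm hb'.1).continuousAt) hline.continuousAt
    exact (ContinuousAlternatingMap.apply ℝ (EuclideanSpace ℝ (Fin d)) ℝ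
      (fun _ : Fin 1 => b - a)).continuous.continuousAt.comp h1
  have hderiv : ∀ t ∈ Set.uIcc (0 : ℝ) 1, HasDerivAt
      (fun t : ℝ => (g ∘ (extChartAt (𝓡 d) q).symm) (AffineMap.lineMap a b t))
      (η.inChart q (AffineMap.lineMap a b t) (fun _ => b - a) -
        η'.inChart q (AffineMap.lineMap a b t) (fun _ => b - a)) t := fun t ht => by
    have hb' := hball (hmem t ht)
    obtain ⟨h1, h2⟩ := Form.extd_ofFun_inChart hb'.1 (hg _ hb'.2) (fun _ => b - a)
    have h3 : (Form.ofFun d g).extd.inChart q (AffineMap.lineMap a b t) =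
        η.inChart q (AffineMap.lineMap a b t) - η'.inChart q (AffineMap.lineMap a b t) := by
      rw [Form.inChart_def, Form.val, hd _ hb'.2]
      rfl
    have h4 := h1.hasFDerivAt.comp_hasDerivAt t (AffineMap.hasDerivAt_lineMap (a := a) (b := b))
    rw [← h2, h3] at h4
    exact h4
  rw [Form.segmentIntegral, Form.segmentIntegral, ← ha, ← hb,
    ← intervalIntegral.integral_sub (hint η hη) (hint η' hη'),
    intervalIntegral.integral_eq_sub_of_hasDerivAt hderiv ((hint η hη).sub (hint η' hη'))]
  simp [ha, hb, extChartAt_symm_apply hxs, extChartAt_symm_apply hys, -extChartAt]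

theorem Form.extd_ofFun_const (c : ℝ) (x : X) :
    (Form.ofFun d (fun _ : X => c)).SmoothAt x ∧ (Form.ofFun d (fun _ : X => c)).extd x = 0 := by
  refine ⟨Form.ofFun_smoothAt_iff.2 contMDiffAt_const, ?_⟩
  have hin : (Form.ofFun d (fun _ : X => c)).inChart x = fun _ =>
      ContinuousAlternatingMap.constOfIsEmpty ℝ (EuclideanSpace ℝ (Fin d)) (Fin 0) c := rfl
  rw [Form.extd, hin, extDeriv_constOfIsEmpty]
  rw [fderiv_fun_const]
  ext v
  rfl

/-- Functions that differ by a constant have the same differential. -/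
theorem Form.extd_ofFun_of_sub_const {u g : X → ℝ} {x : X} {c : ℝ}
    (hg : (Form.ofFun d g).SmoothAt x) (h : ∀ᶠ y in 𝓝 x, u y = g y + c) :
    (Form.ofFun d u).SmoothAt x ∧ (Form.ofFun d u).extd x = (Form.ofFun d g).extd x := by
  obtain ⟨hc, hc'⟩ := Form.extd_ofFun_const (d := d) (X := X) c x
  have he : ∀ᶠ z in 𝓝 x, Form.ofFun d u z = (Form.ofFun d g + Form.ofFun d (fun _ => c) : Form d X 0) z :=
    h.mono fun z hz => by
      rw [Form.ofFun, hz]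
      rfl
  refine ⟨(hg.add hc).congr he, ?_⟩
  rw [Form.extd_congr he, hg.extd_add hc, hc', add_zero]

variable [T2Space X] [SecondCountableTopology X]

/-- Integration of `1`-forms between nearby points of `U`, with values that are well defined on
exact forms. -/
theorem exists_path_cochain {U : Set X} (hU : IsOpen U) :
    ∃ l : Form d X 1 → X → X → ℝ, (∀ x y, l 0 x y = 0) ∧
      ∀ (η η' : Form d X 1) (g : X → ℝ) (V : Set X) (p : X), p ∈ U → IsOpen V → p ∈ V →
        η.SmoothOn V → η'.SmoothOn V → (Form.ofFun d g).SmoothOn V →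
        (∀ x ∈ V, (Form.ofFun d g).extd x = η x - η' x) →
        ∃ M ∈ 𝓝 p, ∀ x ∈ M, ∀ y ∈ M, l η x y - l η' x y = g y - g x := by
  obtain ⟨ind, hind⟩ := exists_index_function hU
    (S := fun q => (chartAt (EuclideanSpace ℝ (Fin d)) q).source)
    (fun q => (chartAt (EuclideanSpace ℝ (Fin d)) q).open_source)
    (fun q _ => mem_chart_source _ q) d
  -- The chart is dictated by the first point and is the same for all forms, so an exact difference
  -- integrates to `g y - g x` whichever chart is used.
  refine ⟨fun η x y => η.segmentIntegral (ind x) x y,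
    fun x y => Form.segmentIntegral_zero _ _ _, ?_⟩
  intro η η' g V p hpU hV hp hη hη' hg hd
  obtain ⟨F, hF, hev⟩ := hind p hpU
  have hM : ∀ q ∈ F, ∃ M ∈ 𝓝 p, ∀ x ∈ M, ∀ y ∈ M,
      η.segmentIntegral q x y - η'.segmentIntegral q x y = g y - g x := fun q hq =>
    Form.exists_segmentIntegral_sub hV hp (hF q hq).2 hη hη' hg hd
  choose! M hM hMd using hM
  refine ⟨{x | ind x ∈ F} ∩ ⋂ q ∈ F, M q,
    Filter.inter_mem hev ((Filter.biInter_finset_mem F).2 hM), ?_⟩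
  rintro x ⟨hx, hxM⟩ y ⟨-, hyM⟩
  exact hMd _ hx x (Set.mem_iInter₂.1 hxM _ hx) y (Set.mem_iInter₂.1 hyM _ hx)

end Cochain

end GerbeTorus
end

noncomputable section
namespace GerbeTorus
set_option maxSynthPendingDepth 3

/-! ### Exactness of closed forms on contractible open sets -/

section Exactness

open Topology

variable {d : ℕ} {X : Type*} [TopologicalSpace X] [ChartedSpace (EuclideanSpace ℝ (Fin d)) X]

theorem Form.ofFun_sub (u v : X → ℝ) :
    Form.ofFun d (fun x => u x - v x) = Form.ofFun d u - Form.ofFun d v := by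
  ext x w
  rfl

variable [IsManifold (𝓡 d) ∞ X] [T2Space X] [SecondCountableTopology X]

/-- A closed `1`-form on a contractible open set is exact. -/
theorem Form.exists_primitive_of_contractible {θ : Form d X 1} {U : Set X} (hU : IsOpen U)
    [ContractibleSpace U] (hθ : θ.SmoothOn U) (hcl : ∀ x ∈ U, θ.extd x = 0) :
    ∃ u : X → ℝ, ContMDiffOn (𝓡 d) 𝓘(ℝ, ℝ) ∞ u U ∧ ∀ x ∈ U, (Form.ofFun d u).extd x = θ x := by
  classical
  obtain ⟨l, hl0, hl⟩ := exists_path_cochain (d := d) hU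
  have hloc : ∀ p ∈ U, ∃ V : Set X, ∃ g : X → ℝ, IsOpen V ∧ p ∈ V ∧ (Form.ofFun d g).SmoothOn V ∧
      (∀ x ∈ V, (Form.ofFun d g).extd x = θ x) ∧
      ∃ M ∈ 𝓝 p, ∀ x ∈ M, ∀ y ∈ M, l θ x y = g y - g x := by
    intro p hp
    obtain ⟨V, η, hV, hpV, hVU, -, hη, hηθ⟩ := Form.exists_local_primitive hU hθ hcl hp
    obtain ⟨g, rfl⟩ := η.exists_eq_ofFun
    have hz : (0 : Form d X 1).SmoothOn V := (Form.smoothOn_iff hV).2 fun x _ =>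
      show ContDiffAt ℝ ∞ (fun _ => 0) _ from contDiffAt_const
    obtain ⟨M, hM, h⟩ := hl θ 0 g V p hp hV hpV
      ((Form.smoothOn_iff hV).2 fun x hx => (Form.smoothOn_iff hU).1 hθ x (hVU hx)) hz hη
      (fun x hx => by rw [hηθ x hx]; exact (sub_zero _).symm)
    refine ⟨V, g, hV, hpV, hη, hηθ, M, hM, fun x hx y hy => ?_⟩
    rw [← h x hx y hy, hl0, sub_zero]
  -- Local primitives make the integration cochain a local difference; contractibility supplies one
  -- function for all of `U`.
  obtain ⟨f, hf⟩ := exists_eq_sub_of_contractible (fun x y : U => l θ x y) (fun p => by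
    obtain ⟨-, g, -, -, -, -, M, hM, h⟩ := hloc p p.2
    exact ⟨Subtype.val ⁻¹' M, continuous_subtype_val.continuousAt.preimage_mem_nhds hM,
      fun x => g x, fun x hx y hy => h x hx y hy⟩)
  let u : X → ℝ := fun x => if h : x ∈ U then f ⟨x, h⟩ else 0
  have hu : ∀ p ∈ U, (Form.ofFun d u).SmoothAt p ∧ (Form.ofFun d u).extd p = θ p := by
    intro p hp
    obtain ⟨V, g, hV, hpV, hg, hgθ, M, hM, h⟩ := hloc p hp
    obtain ⟨N, hN, hfN⟩ := hf ⟨p, hp⟩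
    -- `u` and `g` have the same increments near `p`, so `u` inherits smoothness and differential
    -- from `g`.
    have hev : ∀ᶠ x in 𝓝 p, u x = g x + (u p - g p) := by
      rw [← hU.isOpenEmbedding_subtypeVal.map_nhds_eq ⟨p, hp⟩, Filter.eventually_map]
      filter_upwards [hN, continuous_subtype_val.continuousAt.preimage_mem_nhds hM] with x hx hxM
      have h1 := hfN ⟨p, hp⟩ (mem_of_mem_nhds hN) x hx
      have h2 := h p (mem_of_mem_nhds hM) x hxM
      have h3 : u x = f x := dif_pos x.2
      have h4 : u p = f ⟨p, hp⟩ := dif_pos hp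
      rw [h3, h4]
      change l θ p x = f x - f ⟨p, hp⟩ at h1
      linarith
    obtain ⟨h1, h2⟩ := Form.extd_ofFun_of_sub_const ((Form.smoothOn_iff hV).1 hg p hpV) hev
    exact ⟨h1, h2.trans (hgθ p hpV)⟩
  exact ⟨u, (Form.ofFun_smoothOn_iff hU).1 ((Form.smoothOn_iff hU).2 fun p hp => (hu p hp).1),
    fun p hp => (hu p hp).2⟩

/-- Local primitives of `θ` that differ by differentials of differences of functions glue. -/
theorem Form.exists_primitive_of_local_potentials {θ : Form d X 2} {U : Set X}
    (hU : IsOpen U) {N : X → Set X} {η : X → Form d X 1} {φ : X → X → ℝ}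
    (hN : ∀ p, IsOpen (N p)) (hpN : ∀ p ∈ U, p ∈ N p)
    (hη : ∀ p ∈ U, ∀ r ∈ N p, (η p).SmoothAt r ∧ (η p).extd r = θ r)
    (hφ : ∀ p ∈ U, ∀ q ∈ U, ∀ r ∈ N p, r ∈ N q → r ∈ U →
      (Form.ofFun d (fun x => φ p x - φ q x)).SmoothAt r ∧
      (Form.ofFun d (fun x => φ p x - φ q x)).extd r = η p r - η q r) :
    ∃ η' : Form d X 1, η'.SmoothOn U ∧ ∀ x ∈ U, η'.extd x = θ x := by
  obtain ⟨σ, hσ, hF⟩ := exists_smooth_partition (d := d) hU hN hpN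
  -- The individual `φ p` and the average `Φ` need not be smooth, but `φ p - Φ = ∑ σ q (φ p - φ q)`
  -- is.
  let Φ : X → ℝ := fun x => ∑ᶠ q, σ q x * φ q x
  let ψ : X → Form d X 0 := fun p => Form.ofFun d (fun x => φ p x - Φ x)
  have hψ : ∀ p ∈ U, ∀ r ∈ N p, r ∈ U → (ψ p).SmoothAt r := by
    intro p hp r hr hrU
    obtain ⟨F, hFN, hev⟩ := hF r hrU
    refine Form.ofFun_smoothAt_iff.2 ?_
    have hsm : ContMDiffAt (𝓡 d) 𝓘(ℝ, ℝ) ∞ (fun x => ∑ q ∈ F, σ q x * (φ p x - φ q x)) r :=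
      ContMDiffAt.sum fun q hq => ContMDiffAt.mul ((hσ q).contMDiffAt (hU.mem_nhds hrU))
        (Form.ofFun_smoothAt_iff.1 (hφ p hp q (hFN q hq).1 r hr (hFN q hq).2 hrU).1)
    refine hsm.congr_of_eventuallyEq (hev.mono fun x hx => ?_)
    have hΦ : Φ x = ∑ q ∈ F, σ q x * φ q x := finsum_eq_sum_of_support_subset _ fun q hq => by
      by_contra hn
      exact hq (by simp [hx.1 q hn])
    simp only [hΦ, mul_sub, Finset.sum_sub_distrib, ← Finset.sum_mul, hx.2, one_mul]
  have hUN : ∀ p ∈ U, ∀ᶠ x in 𝓝 p, x ∈ U ∧ x ∈ N p := fun p hp =>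
    (hU.eventually_mem hp).and ((hN p).eventually_mem (hpN p hp))
  -- Gluing: `η x - η p = d(φ x - φ p) = dψ x - dψ p`, so the corrected primitives agree where they
  -- are both defined.
  have hloc : ∀ p ∈ U, ∀ᶠ x in 𝓝 p, (η x x - (ψ x).extd x) = (η p - (ψ p).extd : Form d X 1) x := by
    intro p hp
    filter_upwards [hUN p hp] with x hx
    obtain ⟨-, h2⟩ := hφ x hx.1 p hp x (hpN x hx.1) hx.2 hx.1
    have h3 : Form.ofFun d (fun y => φ x y - φ p y) = ψ x - ψ p := by
      rw [← Form.ofFun_sub]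
      congr 1
      funext y
      ring
    rw [h3, (hψ x hx.1 x (hpN x hx.1) hx.1).extd_sub (hψ p hp x hx.2 hx.1)] at h2
    have : (η p - (ψ p).extd : Form d X 1) x = η p x - (ψ p).extd x := rfl
    rw [this, sub_eq_sub_iff_sub_eq_sub, h2]
  have hopen : ∀ p, IsOpen (N p ∩ U) := fun p => (hN p).inter hU
  have hψ' : ∀ p ∈ U, (ψ p).SmoothOn (N p ∩ U) := fun p hp =>
    (Form.smoothOn_iff (hopen p)).2 fun r hr => hψ p hp r hr.1 hr.2
  refine ⟨fun x => η x x - (ψ x).extd x, (Form.smoothOn_iff hU).2 fun p hp => ?_,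
    fun p hp => ?_⟩
  all_goals
    have h1 : (ψ p).extd.SmoothAt p :=
      (Form.smoothOn_iff (hopen p)).1 ((hψ' p hp).extd (hopen p)) p ⟨hpN p hp, hp⟩
    obtain ⟨h2, h3⟩ := hη p hp p (hpN p hp)
  · exact (h2.sub h1).congr (hloc p hp)
  · rw [Form.extd_congr (hloc p hp), h2.extd_sub h1, h3,
      (hψ' p hp).extd_extd (hopen p) ⟨hpN p hp, hp⟩, sub_zero]

/-- A closed `2`-form on a contractible open set is exact. -/
theorem Form.exists_one_form_primitive_of_contractible {θ : Form d X 2} {U : Set X}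
    (hU : IsOpen U) [ContractibleSpace U] (hθ : θ.SmoothOn U) (hcl : ∀ x ∈ U, θ.extd x = 0) :
    ∃ η : Form d X 1, η.SmoothOn U ∧ ∀ x ∈ U, η.extd x = θ x := by
  classical
  obtain ⟨l, -, hl⟩ := exists_path_cochain (d := d) hU
  have hloc : ∀ p, ∃ (V : Set X) (η : Form d X 1), IsOpen V ∧ V ⊆ U ∧ (p ∈ U → p ∈ V) ∧
      ∀ x ∈ V, η.SmoothAt x ∧ η.extd x = θ x := by
    intro p
    by_cases hp : p ∈ U
    · obtain ⟨V, η, hV, hpV, hVU, -, hη, hηθ⟩ := Form.exists_local_primitive hU hθ hcl hp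
      exact ⟨V, η, hV, hVU, fun _ => hpV,
        fun x hx => ⟨(Form.smoothOn_iff hV).1 hη x hx, hηθ x hx⟩⟩
    · exact ⟨∅, 0, isOpen_empty, Set.empty_subset _, fun h => (hp h).elim, fun x hx => hx.elim⟩
  choose V η hV hVU hpV hη using hloc
  have hdiff : ∀ p q r, r ∈ V p → r ∈ V q → ∃ g : X → ℝ, (Form.ofFun d g).SmoothAt r ∧
      (Form.ofFun d g).extd r = η p r - η q r ∧
      ∃ M ∈ 𝓝 r, ∀ x ∈ M, ∀ y ∈ M, l (η p) x y - l (η q) x y = g y - g x := by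
    intro p q r hrp hrq
    have ho := (hV p).inter (hV q)
    have hs : (η p - η q).SmoothOn (V p ∩ V q) :=
      (Form.smoothOn_iff ho).2 fun x hx => (hη p x hx.1).1.sub (hη q x hx.2).1
    obtain ⟨W, η', hW, hrW, hWV, -, hη', hd⟩ := Form.exists_local_primitive ho hs
      (fun x hx => by
        rw [(hη p x hx.1).1.extd_sub (hη q x hx.2).1, (hη p x hx.1).2, (hη q x hx.2).2, sub_self])
      ⟨hrp, hrq⟩
    obtain ⟨g, rfl⟩ := η'.exists_eq_ofFun
    exact ⟨g, (Form.smoothOn_iff hW).1 hη' r hrW, hd r hrW,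
      hl (η p) (η q) g W r (hVU p hrp) hW hrW
        ((Form.smoothOn_iff hW).2 fun x hx => (hη p x (hWV hx).1).1)
        ((Form.smoothOn_iff hW).2 fun x hx => (hη q x (hWV hx).2).1) hη' hd⟩
  obtain ⟨ind, hind⟩ := exists_index_function hU hV hpV d
  -- Local primitives of `θ` differ by exact forms, whose cochains have zero coboundary. So the
  -- `2`-cochain representing `θ` does not depend on the primitive selected by `ind`, and it is
  -- locally a coboundary.
  have hcob : ∀ p ∈ U, ∃ M ∈ 𝓝 p, ∀ x ∈ M, ∀ y ∈ M, ∀ z ∈ M,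
      l (η (ind x)) x y + l (η (ind x)) y z - l (η (ind x)) x z =
        l (η p) x y + l (η p) y z - l (η p) x z := by
    intro p hp
    obtain ⟨F, hF, hev⟩ := hind p hp
    have hM : ∀ q ∈ F, ∃ g : X → ℝ, ∃ M ∈ 𝓝 p, ∀ x ∈ M, ∀ y ∈ M,
        l (η q) x y - l (η p) x y = g y - g x := fun q hq => by
      obtain ⟨g, -, -, hg⟩ := hdiff q p p (hF q hq).2 (hpV p hp)
      exact ⟨g, hg⟩
    choose! g M hM hg using hM
    refine ⟨{x | ind x ∈ F} ∩ ⋂ q ∈ F, M q,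
      Filter.inter_mem hev ((Filter.biInter_finset_mem F).2 hM), ?_⟩
    rintro x ⟨hx, hxM⟩ y ⟨-, hyM⟩ z ⟨-, hzM⟩
    have hx' := Set.mem_iInter₂.1 hxM _ hx
    have hy' := Set.mem_iInter₂.1 hyM _ hx
    have hz' := Set.mem_iInter₂.1 hzM _ hx
    have h1 := hg _ hx x hx' y hy'
    have h2 := hg _ hx y hy' z hz'
    have h3 := hg _ hx x hx' z hz'
    linarith
  obtain ⟨a, ha⟩ := exists_eq_coboundary_of_contractible
    (fun x y z : U => l (η (ind x)) x y + l (η (ind x)) y z - l (η (ind x)) x z) (fun p => by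
    obtain ⟨M, hM, h⟩ := hcob p p.2
    exact ⟨Subtype.val ⁻¹' M, continuous_subtype_val.continuousAt.preimage_mem_nhds hM,
      fun x y => l (η p) x y, fun x hx y hy z hz => h x hx y hy z hz⟩)
  let a' : X → X → ℝ := fun x y => if h : x ∈ U ∧ y ∈ U then a ⟨x, h.1⟩ ⟨y, h.2⟩ else 0
  have ha' : ∀ x y (hx : x ∈ U) (hy : y ∈ U), a' x y = a ⟨x, hx⟩ ⟨y, hy⟩ := fun x y hx hy =>
    dif_pos ⟨hx, hy⟩
  have hN : ∀ p, ∃ N : Set X, IsOpen N ∧ (p ∈ U → p ∈ N) ∧ N ⊆ V p ∧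
      ∀ x ∈ N, ∀ y ∈ N, ∀ z ∈ N, l (η p) x y + l (η p) y z - l (η p) x z =
        a' x y + a' y z - a' x z := by
    intro p
    by_cases hp : p ∈ U
    · obtain ⟨M, hM, hMc⟩ := hcob p hp
      obtain ⟨N', hN', ha⟩ := ha ⟨p, hp⟩
      have hev : ∀ᶠ x in 𝓝 p, ∃ h : x ∈ U, (⟨x, h⟩ : U) ∈ N' := by
        rw [← hU.isOpenEmbedding_subtypeVal.map_nhds_eq ⟨p, hp⟩, Filter.eventually_map]
        filter_upwards [hN'] with x hx
        exact ⟨x.2, hx⟩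
      obtain ⟨N, hN, hNo, hpN⟩ := eventually_nhds_iff.1
        ((hev.and (Filter.eventually_mem_set.2 hM)).and ((hV p).eventually_mem (hpV p hp)))
      refine ⟨N, hNo, fun _ => hpN, fun x hx => (hN x hx).2, fun x hx y hy z hz => ?_⟩
      obtain ⟨⟨⟨hxU, hxN⟩, hxM⟩, -⟩ := hN x hx
      obtain ⟨⟨⟨hyU, hyN⟩, hyM⟩, -⟩ := hN y hy
      obtain ⟨⟨⟨hzU, hzN⟩, hzM⟩, -⟩ := hN z hz
      rw [← hMc x hxM y hyM z hzM, ha' x y hxU hyU, ha' y z hyU hzU, ha' x z hxU hzU]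
      exact ha _ hxN _ hyN _ hzN
    · exact ⟨∅, isOpen_empty, fun h => (hp h).elim, Set.empty_subset _, fun x hx => hx.elim⟩
  choose N hNo hpN hNV hNa using hN
  -- Near `p` the cochain `l (η p) - a'` has zero coboundary, so it is the difference of its values
  -- based at `p`; these values serve as the potential `φ p`.
  refine Form.exists_primitive_of_local_potentials (η := η)
    (φ := fun p y => l (η p) p y - a' p y) hU hNo hpN (fun p _ r hr => hη p r (hNV p hr)) ?_
  intro p hp q hq r hrp hrq _
  obtain ⟨g, hg, hgd, M, hM, hMg⟩ := hdiff p q r (hNV p hrp) (hNV q hrq)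
  -- Rebasing both potentials at `r` cancels the common `a' r x` and leaves `l (η p) r x - l (η q) r
  -- x`, an increment of `g`.
  have hev : ∀ᶠ x in 𝓝 r, (l (η p) p x - a' p x) - (l (η q) q x - a' q x) = g x +
      ((l (η p) p r - a' p r) - (l (η q) q r - a' q r) - g r) := by
    filter_upwards [hM, (hNo p).mem_nhds hrp, (hNo q).mem_nhds hrq] with x hxM hxp hxq
    have h1 := hNa p p (hpN p hp) r hrp x hxp
    have h2 := hNa q q (hpN q hq) r hrq x hxq
    have h3 := hMg r (mem_of_mem_nhds hM) x hxM
    linarith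
  obtain ⟨h1, h2⟩ := Form.extd_ofFun_of_sub_const hg hev
  exact ⟨h1, h2.trans hgd⟩

end Exactness

end GerbeTorus
end

noncomputable section
namespace GerbeTorus
set_option maxSynthPendingDepth 3

/-! ### Local logarithms of circle-valued functions -/

section Logarithm

open Topology

variable {d : ℕ} {X : Type*} [TopologicalSpace X] [ChartedSpace (EuclideanSpace ℝ (Fin d)) X]

/-- Locally, a smooth `U(1)`-valued function has a smooth logarithm. -/
theorem exists_local_log {f : X → Circle} {O : Set X} (hO : IsOpen O)
    (hf : ContMDiffOn (𝓡 d) 𝓘(ℝ, ℂ) ∞ (fun x => (f x : ℂ)) O) {p : X} (hp : p ∈ O) :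
    ∃ (V : Set X) (θ : X → ℝ), IsOpen V ∧ p ∈ V ∧ V ⊆ O ∧
      ContMDiffOn (𝓡 d) 𝓘(ℝ, ℝ) ∞ θ V ∧
      ∀ x ∈ V, (f x : ℂ) = f p * Complex.exp (2 * Real.pi * Complex.I * θ x) := by
  have hc : ∀ x ∈ O, ContMDiffAt (𝓡 d) 𝓘(ℝ, ℂ) ∞ (fun x => (f x : ℂ) / f p) x := fun x hx => by
    have h1 : ContDiff ℝ ∞ fun z : ℂ => z / f p := contDiff_id.div_const _
    exact h1.contMDiff.contMDiffAt.comp x (hf.contMDiffAt (hO.mem_nhds hx))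
  have hev : ∀ᶠ x in 𝓝 p, (f x : ℂ) / f p ∈ Complex.slitPlane := by
    refine (hc p hp).continuousAt.eventually_mem (Complex.isOpen_slitPlane.mem_nhds ?_)
    rw [div_self (Circle.coe_ne_zero _)]
    exact Complex.one_mem_slitPlane
  obtain ⟨V, hV, hVo, hpV⟩ := eventually_nhds_iff.1 (hev.and (hO.eventually_mem hp))
  -- Dividing by `f p` moves the value at `p` to `1`, so the principal branch is smooth nearby.
  refine ⟨V, fun x => (Complex.log ((f x : ℂ) / f p)).im / (2 * Real.pi), hVo, hpV,
    fun x hx => (hV x hx).2, fun x hx => ?_, fun x hx => ?_⟩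
  · have h1 : ContDiffAt ℝ ∞ (fun z : ℂ => (Complex.log z).im / (2 * Real.pi))
        ((f x : ℂ) / f p) :=
      ContDiffAt.div_const (Complex.imCLM.contDiff.contDiffAt.comp _
        ((Complex.contDiffAt_log (hV x hx).1).restrict_scalars ℝ)) _
    exact (h1.contMDiffAt.comp x (hc x (hV x hx).2)).contMDiffWithinAt
  · have h1 := Complex.norm_mul_exp_arg_mul_I ((f x : ℂ) / f p)
    have h2 : ‖(f x : ℂ) / f p‖ = 1 := by
      rw [norm_div, Circle.norm_coe, Circle.norm_coe, div_one]
    rw [h2, Complex.ofReal_one, one_mul] at h1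
    have h3 : (2 * Real.pi * Complex.I * ((Complex.log ((f x : ℂ) / f p)).im / (2 * Real.pi) : ℝ)) =
        (Complex.arg ((f x : ℂ) / f p)) * Complex.I := by
      rw [Complex.log_im]
      push_cast
      have : (Real.pi : ℂ) ≠ 0 := by exact_mod_cast Real.pi_ne_zero
      field_simp
    rw [h3, h1, mul_div_cancel₀ _ (Circle.coe_ne_zero _)]

theorem hasDerivAt_const_mul_exp (a : ℂ) (s : ℝ) :
    HasDerivAt (fun s : ℝ => a * Complex.exp (2 * Real.pi * Complex.I * s))
      (2 * Real.pi * Complex.I * (a * Complex.exp (2 * Real.pi * Complex.I * s))) s := by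
  have h1 : HasDerivAt (fun s : ℝ => 2 * Real.pi * Complex.I * (s : ℂ))
      (2 * Real.pi * Complex.I) s := by
    simpa using (Complex.ofRealCLM.hasDerivAt (x := s)).const_mul (2 * Real.pi * Complex.I)
  exact (h1.cexp.const_mul a).congr_deriv (by ring)

theorem mfderiv_of_local_log {f : X → Circle} {θ : X → ℝ} {x : X} {a : ℂ}
    (hθ : ContMDiffAt (𝓡 d) 𝓘(ℝ, ℝ) ∞ θ x)
    (h : ∀ᶠ y in 𝓝 x, (f y : ℂ) = a * Complex.exp (2 * Real.pi * Complex.I * θ y))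
    (v : TangentSpace (𝓡 d) x) :
    1 / (2 * Real.pi * Complex.I) * ((f x : ℂ)⁻¹ *
        (show ℂ from mfderiv (𝓡 d) 𝓘(ℝ, ℂ) (fun y => (f y : ℂ)) x v)) =
      ((show ℝ from mfderiv (𝓡 d) 𝓘(ℝ, ℝ) θ x v : ℝ) : ℂ) := by
  have hE := hasDerivAt_const_mul_exp a (θ x)
  have h1 : HasMFDerivAt (𝓡 d) 𝓘(ℝ, ℂ)
      ((fun s : ℝ => a * Complex.exp (2 * Real.pi * Complex.I * s)) ∘ θ) x _ :=
    hE.hasFDerivAt.hasMFDerivAt.comp x (hθ.mdifferentiableAt (by simp)).hasMFDerivAt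
  have h2 := h1.congr_of_eventuallyEq (f₁ := fun y => (f y : ℂ)) h
  rw [h2.mfderiv]
  have hf := h.self_of_nhds
  have hne : (f x : ℂ) ≠ 0 := Circle.coe_ne_zero _
  have h3 : (show ℂ from ((ContinuousLinearMap.toSpanSingleton ℝ (2 * Real.pi * Complex.I *
      (a * Complex.exp (2 * Real.pi * Complex.I * θ x)))).comp
      (mfderiv (𝓡 d) 𝓘(ℝ, ℝ) θ x)) v) =
      ((show ℝ from mfderiv (𝓡 d) 𝓘(ℝ, ℝ) θ x v : ℝ) : ℂ) *
        (2 * Real.pi * Complex.I * f x) := by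
    rw [hf]
    exact Complex.real_smul
  refine (congrArg (fun z => 1 / (2 * Real.pi * Complex.I) * ((f x : ℂ)⁻¹ * z)) h3).trans ?_
  have : (Real.pi : ℂ) ≠ 0 := by exact_mod_cast Real.pi_ne_zero
  field_simp

section Flow

variable {n : ℕ} [AddAction (Torus n) X]

theorem SmoothTorusAction.hasDerivAt_of_local_log (hact : SmoothTorusAction n d X) (i : Fin n)
    {f : X → Circle} {θ : X → ℝ} {x : X} {a : ℂ} (hθ : ContMDiffAt (𝓡 d) 𝓘(ℝ, ℝ) ∞ θ x)
    (h : ∀ᶠ y in 𝓝 x, (f y : ℂ) = a * Complex.exp (2 * Real.pi * Complex.I * θ y)) :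
    HasDerivAt (fun t => (f (flow i t x) : ℂ)) (f x * lieLog i f x) 0 ∧
      1 / (2 * Real.pi * Complex.I) * lieLog i f x =
        (deriv (fun t => θ (flow i t x)) 0 : ℝ) := by
  have h1 := (hact.lie_ofFun i hθ).1
  have h2 : HasDerivAt (fun t => a * Complex.exp (2 * Real.pi * Complex.I * θ (flow i t x))) _ 0 :=
    HasDerivAt.scomp (h := fun t => θ (flow i t x)) (0 : ℝ)
      (hasDerivAt_const_mul_exp a (θ (flow i 0 x))) h1
  have h3 := h2.congr_of_eventuallyEq (f₁ := fun t => (f (flow i t x) : ℂ))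
    (hact.eventually_flow i h)
  have hne : (f x : ℂ) ≠ 0 := Circle.coe_ne_zero _
  have h4 : lieLog i f x = (f x : ℂ)⁻¹ * _ := congrArg (fun z => (f x : ℂ)⁻¹ * z) h3.deriv
  refine ⟨?_, ?_⟩
  · rw [h4, mul_inv_cancel_left₀ hne]
    exact h3
  · rw [h4, flow_zero, ← h.self_of_nhds, Complex.real_smul]
    have : (Real.pi : ℂ) ≠ 0 := by exact_mod_cast Real.pi_ne_zero
    field_simp

theorem SmoothTorusAction.hasDerivAt_circle_flow (hact : SmoothTorusAction n d X) (i : Fin n)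
    {f : X → Circle} {O : Set X} (hO : IsOpen O)
    (hf : ContMDiffOn (𝓡 d) 𝓘(ℝ, ℂ) ∞ (fun x => (f x : ℂ)) O) {x : X} (hx : x ∈ O) :
    HasDerivAt (fun t => (f (flow i t x) : ℂ)) (f x * lieLog i f x) 0 := by
  obtain ⟨V, θ, hV, hxV, -, hθ, h⟩ := exists_local_log hO hf hx
  exact (hact.hasDerivAt_of_local_log i (hθ.contMDiffAt (hV.mem_nhds hxV))
    (Filter.eventually_of_mem (hV.mem_nhds hxV) h)).1

end Flow

variable [IsManifold (𝓡 d) ∞ X]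

theorem Form.extd_ofFun_apply {u : X → ℝ} {x : X} (hu : ContMDiffAt (𝓡 d) 𝓘(ℝ, ℝ) ∞ u x)
    (v : Fin 1 → TangentSpace (𝓡 d) x) :
    (Form.ofFun d u).extd x v = mfderiv (𝓡 d) 𝓘(ℝ, ℝ) u x (v 0) := by
  have hs := mem_chart_source (EuclideanSpace ℝ (Fin d)) x
  have he := extChartAt_symm_apply hs
  obtain ⟨h1, -⟩ := Form.extd_ofFun_inChart (extChartAt_mem_target hs)
    (Form.ofFun_smoothAt_iff.2 (by rwa [he])) (fun _ => 0)
  have hin : (Form.ofFun d u).inChart x = fun y =>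
      ContinuousAlternatingMap.constOfIsEmpty ℝ (EuclideanSpace ℝ (Fin d)) (Fin 0)
        ((u ∘ (extChartAt (𝓡 d) x).symm) y) := rfl
  have h2 : u =ᶠ[𝓝 x] (u ∘ (extChartAt (𝓡 d) x).symm) ∘ extChartAt (𝓡 d) x := by
    filter_upwards [(chartAt (EuclideanSpace ℝ (Fin d)) x).open_source.mem_nhds hs] with z hz
    simp only [Function.comp_apply, extChartAt_symm_apply hz]
  rw [h2.mfderiv_eq, mfderiv_comp x h1.mdifferentiableAt (mdifferentiableAt_extChartAt' hs),
    mfderiv_eq_fderiv, Form.extd, hin, extDeriv_constOfIsEmpty]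
  rfl

/-- A function with vanishing differential is locally constant. -/
theorem Form.eventually_eq_of_extd_eq_zero {u : X → ℝ} {V : Set X} (hV : IsOpen V)
    (hu : (Form.ofFun d u).SmoothOn V) (h : ∀ x ∈ V, (Form.ofFun d u).extd x = 0) {p : X}
    (hp : p ∈ V) : ∀ᶠ x in 𝓝 p, u x = u p := by
  have hz : (0 : Form d X 1).SmoothOn V := (Form.smoothOn_iff hV).2 fun x _ =>
    show ContDiffAt ℝ ∞ (fun _ => 0) _ from contDiffAt_const
  -- With both `1`-forms zero, the increments of `u` are differences of equal integrals.
  obtain ⟨M, hM, hMu⟩ := Form.exists_segmentIntegral_sub hV hp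
    (mem_chart_source (EuclideanSpace ℝ (Fin d)) p) hz hz hu
    (fun x hx => by rw [h x hx]; exact (sub_zero _).symm)
  filter_upwards [hM] with x hx
  have h1 := hMu p (mem_of_mem_nhds hM) x hx
  rw [sub_self] at h1
  linarith

end Logarithm

end GerbeTorus
end

noncomputable section
namespace GerbeTorus
set_option maxSynthPendingDepth 3

/-! ### Descent for the gerbe connection -/

section GerbeAction

open Topology

variable {n d : ℕ} {X ι : Type*} [TopologicalSpace X]
  [ChartedSpace (EuclideanSpace ℝ (Fin d)) X] {U : ι → Set X}

theorem IsContractibleCover.contractible_single (hU : IsContractibleCover U) (α : ι)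
    (h : (U α).Nonempty) : ContractibleSpace (U α) := by
  have := hU.contractible α α α
  rw [Set.inter_self, Set.inter_self] at this
  exact this h

theorem IsContractibleCover.contractible_inter (hU : IsContractibleCover U) (α β : ι)
    (h : (U α ∩ U β).Nonempty) : ContractibleSpace (U α ∩ U β : Set X) := by
  have := hU.contractible α α β
  rw [Set.inter_self] at this
  exact this h

theorem IsContractibleCover.isOpen_inter (hU : IsContractibleCover U) (α β : ι) :
    IsOpen (U α ∩ U β) := (hU.isOpen α).inter (hU.isOpen β)

theorem IsContractibleCover.isOpen_inter₃ (hU : IsContractibleCover U) (α β γ : ι) :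
    IsOpen (U α ∩ U β ∩ U γ) := (hU.isOpen_inter α β).inter (hU.isOpen γ)

variable [AddAction (Torus n) X] {G : GerbeConnection d U}

/-- The logarithmic derivative along the flow turns the multiplicative cocycle condition into an
additive one. -/
theorem GerbeConnection.lieLog_cocycle (hact : SmoothTorusAction n d X)
    (hU : IsContractibleCover U) (α β γ δ : ι) (i : Fin n) {x : X}
    (hx : x ∈ U α ∩ U β ∩ U γ ∩ U δ) :
    lieLog i (G.f α β γ) x + lieLog i (G.f γ δ α) x =
      lieLog i (G.f β γ δ) x + lieLog i (G.f δ α β) x := by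
  obtain ⟨⟨⟨hα, hβ⟩, hγ⟩, hδ⟩ := hx
  have hd := fun a b c (h : x ∈ U a ∩ U b ∩ U c) =>
    hact.hasDerivAt_circle_flow i (hU.isOpen_inter₃ a b c) (G.smooth_f a b c) h
  have h1 := hd α β γ ⟨⟨hα, hβ⟩, hγ⟩
  have h2 := hd β γ δ ⟨⟨hβ, hγ⟩, hδ⟩
  have h3 := hd γ δ α ⟨⟨hγ, hδ⟩, hα⟩
  have h4 := hd δ α β ⟨⟨hδ, hα⟩, hβ⟩
  have hcoc : ∀ y ∈ U α ∩ U β ∩ U γ ∩ U δ, (G.f α β γ y : ℂ) * G.f γ δ α y =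
      G.f β γ δ y * G.f δ α β y := fun y hy => by
    have h := G.cocycle α β γ δ y hy
    have h' : G.f α β γ y * G.f γ δ α y = G.f β γ δ y * G.f δ α β y := by
      rw [← mul_inv_eq_one.1 h, mul_right_comm, mul_comm (G.f β γ δ y), inv_mul_cancel_right]
    exact_mod_cast congrArg (Subtype.val) h'
  have hev := hact.eventually_flow i (Filter.eventually_of_mem
    (((hU.isOpen_inter₃ α β γ).inter (hU.isOpen δ)).mem_nhds ⟨⟨⟨hα, hβ⟩, hγ⟩, hδ⟩) hcoc)
  have h5 := (h1.mul h3).unique ((h2.mul h4).congr_of_eventuallyEq hev)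
  simp only [flow_zero] at h5
  have h6 := hcoc x ⟨⟨⟨hα, hβ⟩, hγ⟩, hδ⟩
  have hne : (G.f α β γ x : ℂ) * G.f γ δ α x ≠ 0 :=
    mul_ne_zero (Circle.coe_ne_zero _) (Circle.coe_ne_zero _)
  refine mul_left_cancel₀ hne ?_
  linear_combination h5 - (lieLog i (G.f β γ δ) x + lieLog i (G.f δ α β) x) * h6

theorem GerbeConnection.TwofoldCondition.fourfoldCondition
    (hact : SmoothTorusAction n d X) (hU : IsContractibleCover U)
    {w : ι → Fin n → Form d X 1} {u : ι → ι → Fin n → X → ℝ} (hu : G.TwofoldCondition w u)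
    {c : ι → ι → ι → Fin n → ℝ} (hc : G.ThreefoldCondition u c) : FourfoldCondition U c := by
  rintro α β γ δ ⟨x, hx⟩ i
  -- The integer is always zero: `ℒ log f` is single-valued, so no branch of the logarithm enters.
  refine ⟨0, ?_⟩
  have hl := G.lieLog_cocycle hact hU α β γ δ i hx
  obtain ⟨⟨⟨hα, hβ⟩, hγ⟩, hδ⟩ := hx
  have h1 := hc α β γ i x ⟨⟨hα, hβ⟩, hγ⟩
  have h2 := hc β γ δ i x ⟨⟨hβ, hγ⟩, hδ⟩
  have h3 := hc γ δ α i x ⟨⟨hγ, hδ⟩, hα⟩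
  have h4 := hc δ α β i x ⟨⟨hδ, hα⟩, hβ⟩
  have s1 : (u γ α i x : ℂ) = -u α γ i x := by
    exact_mod_cast hu.2.1 α γ i x ⟨hα, hγ⟩
  have s2 : (u δ β i x : ℂ) = -u β δ i x := by
    exact_mod_cast hu.2.1 β δ i x ⟨hβ, hδ⟩
  apply Complex.ofReal_injective
  push_cast at h1 h2 h3 h4 ⊢
  linear_combination (1 / (2 * Real.pi * Complex.I)) * hl - h1 + h2 - h3 + h4 + s1 - s2

variable [IsManifold (𝓡 d) ∞ X]

theorem SmoothTorusAction.lie_neg (hact : SmoothTorusAction n d X) (i : Fin n) {k : ℕ}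
    {η : Form d X k} {x : X} (hη : η.SmoothAt x) : (-η).lie i x = -η.lie i x :=
  (hact.hasDerivAt_pullback i hη).neg.deriv

/-- Near `p` write `f = f p · exp(2πiθ)`. Then `s` is the sum of the `u`'s plus `ℒθ`, which also
shows that the complex expression is real. -/
theorem GerbeConnection.TwofoldCondition.eventually_eq (hact : SmoothTorusAction n d X)
    (hU : IsContractibleCover U) {w : ι → Fin n → Form d X 1} {u : ι → ι → Fin n → X → ℝ}
    (hu : G.TwofoldCondition w u) (α β γ : ι) (i : Fin n) {p : X}
    (hp : p ∈ U α ∩ U β ∩ U γ) :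
    ∃ s : X → ℝ, (∀ᶠ x in 𝓝 p, s x = s p) ∧ ∀ᶠ x in 𝓝 p,
      ((u α β i x + u β γ i x + u γ α i x : ℝ) : ℂ) +
        1 / (2 * Real.pi * Complex.I) * lieLog i (G.f α β γ) x = s x := by
  obtain ⟨V, θ, hV, hpV, hVO, hθ, hlog⟩ := exists_local_log (hU.isOpen_inter₃ α β γ)
    (G.smooth_f α β γ) hp
  have hθ' : ∀ x ∈ V, ContMDiffAt (𝓡 d) 𝓘(ℝ, ℝ) ∞ θ x := fun x hx =>
    hθ.contMDiffAt (hV.mem_nhds hx)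
  have hlog' : ∀ x ∈ V, ∀ᶠ y in 𝓝 x, (G.f α β γ y : ℂ) =
      G.f α β γ p * Complex.exp (2 * Real.pi * Complex.I * θ y) := fun x hx =>
    Filter.eventually_of_mem (hV.mem_nhds hx) hlog
  have hθs : (Form.ofFun d θ).SmoothOn V := (Form.ofFun_smoothOn_iff hV).2 hθ
  let τ : X → ℝ := fun x => deriv (fun t => θ (flow i t x)) 0
  have hτ : ∀ x ∈ V, (Form.ofFun d θ).lie i x = Form.ofFun d τ x := fun x hx =>
    (hact.lie_ofFun i (hθ' x hx)).2
  have hτe : ∀ x ∈ V, ∀ᶠ z in 𝓝 x, (Form.ofFun d θ).lie i z = Form.ofFun d τ z := fun x hx =>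
    Filter.eventually_of_mem (hV.mem_nhds hx) hτ
  have hτs : ∀ x ∈ V, (Form.ofFun d τ).SmoothAt x := fun x hx =>
    ((Form.smoothOn_iff hV).1 (hact.smoothOn_lie i hV hθs) x hx).congr
      ((hτe x hx).mono fun z hz => hz.symm)
  have hA : ∀ x ∈ V, (G.A α β + G.A β γ + G.A γ α) x = (Form.ofFun d θ).extd x := by
    intro x hx
    ext v
    have h1 := G.glue_A α β γ x (hVO hx) (v 0)
    rw [mfderiv_of_local_log (hθ' x hx) (hlog' x hx)] at h1
    have h2 : v = fun _ => v 0 := by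
      funext j
      rw [Subsingleton.elim j 0]
    rw [Form.extd_ofFun_apply (hθ' x hx)]
    refine Eq.trans ?_ (Complex.ofReal_injective h1)
    rw [← h2]
    rfl
  have hAs : ∀ a b, ∀ x ∈ U a ∩ U b, (G.A a b).SmoothAt x ∧ (Form.ofFun d (u a b i)).SmoothAt x :=
    fun a b x hx => ⟨(Form.smoothOn_iff (hU.isOpen_inter a b)).1 (G.smooth_A a b) x hx,
      Form.ofFun_smoothAt_iff.2
        ((hu.1 a b i).contMDiffAt ((hU.isOpen_inter a b).mem_nhds hx))⟩
  let s : X → ℝ := fun x => u α β i x + u β γ i x + u γ α i x + τ x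
  have hsF : Form.ofFun d s = Form.ofFun d (u α β i) + Form.ofFun d (u β γ i) +
      Form.ofFun d (u γ α i) + Form.ofFun d τ := by
    ext x v
    rfl
  have hs : ∀ x ∈ V, (Form.ofFun d s).SmoothAt x ∧ (Form.ofFun d s).extd x = 0 := by
    intro x hx
    obtain ⟨⟨hα, hβ⟩, hγ⟩ := hVO hx
    obtain ⟨h1, h1'⟩ := hAs α β x ⟨hα, hβ⟩
    obtain ⟨h2, h2'⟩ := hAs β γ x ⟨hβ, hγ⟩
    obtain ⟨h3, h3'⟩ := hAs γ α x ⟨hγ, hα⟩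
    rw [hsF]
    refine ⟨((h1'.add h2').add h3').add (hτs x hx), ?_⟩
    have e1 := hu.2.2 α β i x ⟨hα, hβ⟩
    have e2 := hu.2.2 β γ i x ⟨hβ, hγ⟩
    have e3 := hu.2.2 γ α i x ⟨hγ, hα⟩
    -- `dℒθ = ℒdθ`, and `dθ` is the sum of the three `A`'s. In the sum of the three equations for
    -- `du` the `w`'s cancel, leaving minus this quantity.
    have e4 : (Form.ofFun d τ).extd x =
        (G.A α β).lie i x + (G.A β γ).lie i x + (G.A γ α).lie i x := by
      rw [← hact.lie_add i h1 h2, ← hact.lie_add i (h1.add h2) h3,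
        ← Form.extd_congr (hτe x hx), hact.extd_lie i hV hθs hx]
      exact hact.lie_congr i (Filter.eventually_of_mem (hV.mem_nhds hx)
        fun z hz => (hA z hz).symm)
    rw [((h1'.add h2').add h3').extd_add (hτs x hx), (h1'.add h2').extd_add h3',
      h1'.extd_add h2', e4, ← sub_eq_iff_eq_add'.2 e1, ← sub_eq_iff_eq_add'.2 e2,
      ← sub_eq_iff_eq_add'.2 e3]
    abel
  refine ⟨s, Form.eventually_eq_of_extd_eq_zero hV
    ((Form.smoothOn_iff hV).2 fun x hx => (hs x hx).1) (fun x hx => (hs x hx).2) hpV, ?_⟩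
  filter_upwards [hV.mem_nhds hpV] with x hx
  rw [(hact.hasDerivAt_of_local_log i (hθ' x hx) (hlog' x hx)).2]
  exact (Complex.ofReal_add _ _).symm

theorem GerbeConnection.TwofoldCondition.exists_threefoldCondition
    (hact : SmoothTorusAction n d X) (hU : IsContractibleCover U)
    {w : ι → Fin n → Form d X 1} {u : ι → ι → Fin n → X → ℝ} (hu : G.TwofoldCondition w u) :
    ∃ c : ι → ι → ι → Fin n → ℝ, G.ThreefoldCondition u c := by
  have hc : ∀ α β γ (i : Fin n), ∃ c : ℝ, ∀ x ∈ U α ∩ U β ∩ U γ,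
      ((u α β i x + u β γ i x + u γ α i x : ℝ) : ℂ) =
        (c : ℂ) - 1 / (2 * Real.pi * Complex.I) * lieLog i (G.f α β γ) x := by
    intro α β γ i
    rcases (U α ∩ U β ∩ U γ).eq_empty_or_nonempty with he | ⟨x₀, hx₀⟩
    · exact ⟨0, fun x hx => by rw [he] at hx; exact hx.elim⟩
    have := hU.contractible α β γ ⟨x₀, hx₀⟩
    have ho := hU.isOpen_inter₃ α β γ
    let S : X → ℂ := fun x => ((u α β i x + u β γ i x + u γ α i x : ℝ) : ℂ) +
        1 / (2 * Real.pi * Complex.I) * lieLog i (G.f α β γ) x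
    -- Contractibility of the triple overlap enters only through its connectedness.
    have hlc : IsLocallyConstant fun x : (U α ∩ U β ∩ U γ : Set X) => S x := by
      rw [IsLocallyConstant.iff_eventually_eq]
      intro p
      obtain ⟨s, hs, hS⟩ := hu.eventually_eq hact hU α β γ i p.2
      have hev : ∀ᶠ x in 𝓝 (p : X), S x = S p := by
        filter_upwards [hs, hS] with x h1 h2
        exact h2.trans ((congrArg _ h1).trans hS.self_of_nhds.symm)
      exact continuous_subtype_val.continuousAt.eventually hev
    obtain ⟨s, -, hS⟩ := hu.eventually_eq hact hU α β γ i hx₀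
    refine ⟨s x₀, fun x hx => ?_⟩
    have h1 : S x = S x₀ := hlc.apply_eq_of_preconnectedSpace ⟨x, hx⟩ ⟨x₀, hx₀⟩
    exact eq_sub_of_add_eq (h1.trans hS.self_of_nhds)
  choose c hc using hc
  exact ⟨c, hc⟩

variable [T2Space X] [SecondCountableTopology X]

theorem GerbeConnection.exists_patchCondition (hact : SmoothTorusAction n d X)
    (hU : IsContractibleCover U) {H : Form d X 3} (hH : G.IsCurvature H) (hinv : H.Invariant n) :
    ∃ w : ι → Fin n → Form d X 1, G.PatchCondition w := by
  have hw : ∀ α (i : Fin n), ∃ w : Form d X 1, w.SmoothOn (U α) ∧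
      ∀ x ∈ U α, w.extd x = (G.B α).lie i x := by
    intro α i
    rcases (U α).eq_empty_or_nonempty with he | hne
    · rw [he]
      exact ⟨0, (Form.smoothOn_iff isOpen_empty).2 fun x hx => hx.elim, fun x hx => hx.elim⟩
    · have := hU.contractible_single α hne
      have hs := hact.smoothOn_lie i (hU.isOpen α) (G.smooth_B α)
      refine Form.exists_one_form_primitive_of_contractible (hU.isOpen α) hs fun x hx => ?_
      -- `dℒB = ℒdB = ℒH = 0`, the only place where invariance of the curvature enters.
      rw [hact.extd_lie i (hU.isOpen α) (G.smooth_B α) hx, ← hinv.lie_eq_zero i x]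
      exact hact.lie_congr i (Filter.eventually_of_mem ((hU.isOpen α).mem_nhds hx)
        fun z hz => (hH α z hz).symm)
  choose w hw hwd using hw
  exact ⟨w, hw, fun α i x hx => (hwd α i x hx).symm⟩

theorem GerbeConnection.PatchCondition.exists_primitive (hact : SmoothTorusAction n d X)
    (hU : IsContractibleCover U) {w : ι → Fin n → Form d X 1} (hw : G.PatchCondition w)
    (α β : ι) (i : Fin n) :
    ∃ u : X → ℝ, ContMDiffOn (𝓡 d) 𝓘(ℝ, ℝ) ∞ u (U α ∩ U β) ∧ ∀ x ∈ U α ∩ U β,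
      w α i x - w β i x = (G.A α β).lie i x + (Form.ofFun d u).extd x := by
  rcases (U α ∩ U β).eq_empty_or_nonempty with he | hne
  · rw [he]
    exact ⟨fun _ => 0, fun x hx => hx.elim, fun x hx => hx.elim⟩
  have := hU.contractible_inter α β hne
  have ho := hU.isOpen_inter α β
  have hwα := (Form.smoothOn_iff (hU.isOpen α)).1 (hw.1 α i)
  have hwβ := (Form.smoothOn_iff (hU.isOpen β)).1 (hw.1 β i)
  have hB := fun γ => (Form.smoothOn_iff (hU.isOpen γ)).1 (G.smooth_B γ)
  have hL := (Form.smoothOn_iff ho).1 (hact.smoothOn_lie i ho (G.smooth_A α β))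
  have hs : (w α i - w β i - (G.A α β).lie i).SmoothOn (U α ∩ U β) :=
    (Form.smoothOn_iff ho).2 fun x hx => ((hwα x hx.1).sub (hwβ x hx.2)).sub (hL x hx)
  -- Closedness: `d(w_α - w_β) = ℒ(B_α - B_β) = ℒdA_αβ = dℒA_αβ`.
  obtain ⟨u, hu, hud⟩ := Form.exists_primitive_of_contractible ho hs fun x hx => by
    rw [((hwα x hx.1).sub (hwβ x hx.2)).extd_sub (hL x hx), (hwα x hx.1).extd_sub (hwβ x hx.2),
      hact.extd_lie i ho (G.smooth_A α β) hx, ← hw.2 α i x hx.1, ← hw.2 β i x hx.2,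
      ← hact.lie_sub i (hB α x hx.1) (hB β x hx.2), sub_eq_zero]
    exact hact.lie_congr i (Filter.eventually_of_mem (ho.mem_nhds hx) fun z hz =>
      G.glue_B α β z hz)
  refine ⟨u, hu, fun x hx => ?_⟩
  rw [hud x hx]
  exact (add_sub_cancel _ _).symm

theorem GerbeConnection.PatchCondition.exists_twofoldCondition (hact : SmoothTorusAction n d X)
    (hU : IsContractibleCover U) {w : ι → Fin n → Form d X 1} (hw : G.PatchCondition w) :
    ∃ u : ι → ι → Fin n → X → ℝ, G.TwofoldCondition w u := by
  choose u hu hud using hw.exists_primitive hact hU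
  have hu' : ∀ α β i, ContMDiffOn (𝓡 d) 𝓘(ℝ, ℝ) ∞ (u β α i) (U α ∩ U β) := fun α β i => by
    rw [Set.inter_comm]
    exact hu β α i
  -- The primitives for `(α, β)` and `(β, α)` were chosen independently. Since `w_α - w_β - ℒA_αβ`
  -- is skew in the indices, the skew part of `u` has the same differential.
  refine ⟨fun α β i x => (1 / 2) * (u α β i x - u β α i x), fun α β i => ?_, fun α β i x _ => ?_,
    fun α β i x hx => ?_⟩
  · exact contMDiffOn_const.mul ((hu α β i).sub (hu' α β i))
  · ring
  · have ho := hU.isOpen_inter α β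
    have hs := (Form.smoothOn_iff ho).1 ((Form.ofFun_smoothOn_iff ho).2 (hu α β i)) x hx
    have hs' := (Form.smoothOn_iff ho).1 ((Form.ofFun_smoothOn_iff ho).2 (hu' α β i)) x hx
    have h1 : (Form.ofFun d fun x => (1 / 2) * (u α β i x - u β α i x)).extd x =
        (1 / 2 : ℝ) • (Form.ofFun d (u α β i)).extd x -
          (1 / 2 : ℝ) • (Form.ofFun d (u β α i)).extd x := by
      have h2 : (Form.ofFun d fun x => (1 / 2) * (u α β i x - u β α i x)).inChart x =
          (1 / 2 : ℝ) • (Form.ofFun d (u α β i) - Form.ofFun d (u β α i)).inChart x := by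
        funext y
        ext v
        rfl
      rw [← smul_sub, ← hs.extd_sub hs', Form.extd, h2, extDeriv_smul]
      rfl
    have h3 := hud α β i x hx
    have h4 := hud β α i x ⟨hx.2, hx.1⟩
    have h5 : (G.A β α).lie i x = -(G.A α β).lie i x := by
      rw [← hact.lie_neg i ((Form.smoothOn_iff ho).1 (G.smooth_A α β) x hx)]
      exact hact.lie_congr i (Filter.eventually_of_mem (ho.mem_nhds hx) fun z hz =>
        G.skew_A α β z hz)
    rw [h1]
    have h6 : (Form.ofFun d (u α β i)).extd x = w α i x - w β i x - (G.A α β).lie i x := by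
      rw [h3, add_sub_cancel_left]
    have h7 : (Form.ofFun d (u β α i)).extd x = w β i x - w α i x + (G.A α β).lie i x := by
      rw [h4, h5]
      abel
    rw [h6, h7, ← smul_sub]
    have h8 : w α i x - w β i x - (G.A α β).lie i x - (w β i x - w α i x + (G.A α β).lie i x) =
        (2 : ℝ) • (w α i x - w β i x - (G.A α β).lie i x) := by
      rw [two_smul]
      abel
    rw [h8, smul_smul]
    norm_num

end GerbeAction

end GerbeTorus
end

theorem mainTheorem9 {n d : ℕ} {X ι : Type*} [TopologicalSpace X] [T2Space X]
    [SecondCountableTopology X] [ChartedSpace (EuclideanSpace ℝ (Fin d)) X]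
    [IsManifold (𝓡 d) ∞ X]
    [AddAction (GerbeTorus.Torus n) X] (hact : GerbeTorus.SmoothTorusAction n d X)
    (U : ι → Set X) (hU : GerbeTorus.IsContractibleCover U)
    (G : GerbeTorus.GerbeConnection d U)
    (H : GerbeTorus.Form d X 3) (hH : G.IsCurvature H) (hinv : H.Invariant n) :
    (∃ w : ι → Fin n → GerbeTorus.Form d X 1, G.PatchCondition w) ∧
    ∀ w : ι → Fin n → GerbeTorus.Form d X 1, G.PatchCondition w →
      (∃ u : ι → ι → Fin n → X → ℝ, G.TwofoldCondition w u) ∧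
      ∀ u : ι → ι → Fin n → X → ℝ, G.TwofoldCondition w u →
        (∃ c : ι → ι → ι → Fin n → ℝ, G.ThreefoldCondition u c) ∧
        ∀ c : ι → ι → ι → Fin n → ℝ, G.ThreefoldCondition u c →
          GerbeTorus.FourfoldCondition U c := by
  refine ⟨GerbeTorus.GerbeConnection.exists_patchCondition hact hU hH hinv, fun w hw =>
    ⟨hw.exists_twofoldCondition hact hU, fun u hu =>
      ⟨hu.exists_threefoldCondition hact hU, fun c hc => hu.fourfoldCondition hact hU hc⟩⟩⟩
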